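/- Let $w=w[1]\cdots w[n]$, $n\ge 1$, be a string of non-negative integers. A run-length straight-line program (RLSLP) generating $w$ has finitely many, linearly ordered variables, one rule per variable, of the form $A\to a$ ($a$ a terminal), $A\to A_1\cdots A_k$ with $k>1$, or $A\to B^t$ with $t>2$, where the variables on the right-hand side are smaller than $A$; the greatest variable is the start variable and derives $w$. Its size is the sum of the lengths of its right-hand sides, where $B^t$ counts as $2$, and $g_{rl}=g_{rl}(w)$ is the smallest size of an RLSLP generating $w$. For an integer $c$ and a prime $\mu$, the Karp--Rabin fingerprint of a string $x=x[1]\cdots x[m]$ is $\kappa(x)=\bigl(\sum_{i=1}^{m}x[i]\,c^{\,i-1}\bigr)\bmod\mu$. Theorem. There is a fixed word-RAM program (unit-cost word addition, subtraction, multiplication, division, remainder, comparison, and indirect memory access) such that the following holds, with absolute constants. For every such $w$, every integer $c$ and every prime $\mu$, and for machine words of $W\ge K\log_2(n+\mu)$ bits ($K$ an absolute constant), there is an index for $w$ consisting of $\mathcal{O}(g_{rl})$ machine words from which the program computes, for every $0\le j\le n$, the fingerprint $\kappa(w[1:j])$ in $\mathcal{O}(1+\log n)$ steps (that is, $\mathcal{O}(\log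 n)$ for $n\ge2$), using no memory besides the index and $\mathcal{O}(1)$ registers and leaving the index unchanged. -/

import Mathlib

/-! ## Run-length straight-line programs -/

/-- The right-hand side of the rule of the `i`-th variable of an RLSLP with terminals in `α`.
Variables are numbered `0, 1, 2, …`, and the rule of variable `i` may refer only to variables
smaller than `i`. -/
inductive RLRule (α : Type*) (i : ℕ) where
  /-- `A → a` for a terminal `a` -/
  | terminal (a : α)
  /-- `A → A₁ A₂ ⋯ Aₖ` with `k > 1` -/
  | seq (Bs : List (Fin i)) (hk : 1 < Bs.length)
  /-- the run-length rule `A → B ^ t` with `t > 2` -/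
  | power (B : Fin i) (t : ℕ) (ht : 2 < t)

/-- The size of a right-hand side: its length, where a run-length rule counts 2. -/
def RLRule.size {α : Type*} {i : ℕ} : RLRule α i → ℕ
  | .terminal _ => 1
  | .seq Bs _ => Bs.length
  | .power _ _ _ => 2

/-- A run-length straight-line program: the variables are `0, …, top`, each has exactly one rule,
and the greatest variable `top` is the start variable. -/
structure RLSLP (α : Type*) where
  top : ℕ
  rule : (i : Fin (top + 1)) → RLRule α i

namespace RLSLP

variable {α : Type*}

/-- The string derived from variable `i`. -/
def expand (G : RLSLP α) (i : ℕ) (hi : i < G.top + 1) : List α :=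
  match G.rule ⟨i, hi⟩ with
  | .terminal a => [a]
  | .seq Bs _ => Bs.flatMap fun B => G.expand B.1 (B.2.trans hi)
  | .power B t _ => (List.replicate t (G.expand B.1 (B.2.trans hi))).flatten
termination_by i
decreasing_by
  all_goals exact B.2

/-- The string generated by the program. -/
def word (G : RLSLP α) : List α := G.expand G.top (Nat.lt_succ_self _)

/-- The size of the program: the sum of the sizes of its rules. -/
def size (G : RLSLP α) : ℕ := ∑ i : Fin (G.top + 1), (G.rule i).size

end RLSLP

/-- `g_rl`: the size of the smallest RLSLP generating the (nonempty) string `w`. -/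
noncomputable def grl {α : Type*} (w : List α) : ℕ :=
  sInf {s | ∃ G : RLSLP α, G.word = w ∧ G.size = s}

/-! ## Karp-Rabin fingerprints -/

/-- `κ(x) = (∑ i, x[i] * c ^ i) mod μ`, with positions counted from `0`. -/
def karpRabin (c : ℤ) (μ : ℕ) (x : List ℕ) : ℕ :=
  ((∑ i : Fin x.length, (x.get i : ℤ) * c ^ (i : ℕ)) % (μ : ℤ)).toNat

/-! ## The word RAM

A word of `W` bits is a natural number below `2 ^ W`. A program is a finite list of instructions;
it uses the (finitely many) registers that it mentions and a memory of a fixed number of cells.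
Every instruction costs one step. -/

/-- The arithmetic operations on words. -/
inductive RAMOp where
  | add | sub | mul | div | mod

/-- Word arithmetic, modulo `2 ^ W`. -/
def RAMOp.eval (W : ℕ) : RAMOp → ℕ → ℕ → ℕ
  | .add, x, y => (x + y) % 2 ^ W
  | .sub, x, y => (x + (2 ^ W - y)) % 2 ^ W
  | .mul, x, y => (x * y) % 2 ^ W
  | .div, x, y => (x / y) % 2 ^ W
  | .mod, x, y => (x % y) % 2 ^ W

/-- The instructions; `d`, `a`, `b` are register numbers and `l` is a program position. -/
inductive RAMInstr where
  /-- `R[d] := v` -/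
  | const (d v : ℕ)
  /-- `R[d] := R[a] ∘ R[b]` -/
  | arith (o : RAMOp) (d a b : ℕ)
  /-- `R[d] := M[R[a]]` -/
  | load (d a : ℕ)
  /-- `M[R[a]] := R[b]` -/
  | store (a b : ℕ)
  /-- go to `l` -/
  | jump (l : ℕ)
  /-- if `R[a] < R[b]`, go to `l` -/
  | jumpLt (a b l : ℕ)
  /-- if `R[a] = R[b]`, go to `l` -/
  | jumpEq (a b l : ℕ)
  | halt

/-- A machine state: program counter, registers and memory. -/
structure RAMState where
  pc : ℕ
  reg : ℕ → ℕ
  mem : List ℕ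

namespace RAMState

/-- Put `v` into register `d` and go to the next instruction. -/
def setReg (s : RAMState) (d v : ℕ) : RAMState :=
  { s with pc := s.pc + 1, reg := Function.update s.reg d v }

/-- Continue at `l` if `b` holds, and at the next instruction otherwise. -/
def branch (s : RAMState) (b : Bool) (l : ℕ) : RAMState :=
  { s with pc := if b then l else s.pc + 1 }

/-- One step with words of `W` bits. There is no next state if the machine has halted, if the
program counter is outside the program, or if a memory access is out of range. -/
def step (P : List RAMInstr) (W : ℕ) (s : RAMState) : Option RAMState :=
  match P[s.pc]? with
  | none => none
  | some .halt => none
  | some (.const d v) => some (s.setReg d (v % 2 ^ W))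
  | some (.arith o d a b) => some (s.setReg d (o.eval W (s.reg a) (s.reg b)))
  | some (.load d a) => (s.mem[s.reg a]?).map fun v => s.setReg d v
  | some (.store a b) =>
      if s.reg a < s.mem.length then
        some { s with pc := s.pc + 1, mem := s.mem.set (s.reg a) (s.reg b) }
      else none
  | some (.jump l) => some (s.branch true l)
  | some (.jumpLt a b l) => some (s.branch (decide (s.reg a < s.reg b)) l)
  | some (.jumpEq a b l) => some (s.branch (decide (s.reg a = s.reg b)) l)

/-- The state after exactly `k` steps, if there is one. -/
def run (P : List RAMInstr) (W : ℕ) : ℕ → RAMState → Option RAMState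
  | 0, s => some s
  | k + 1, s => (s.step P W).bind (run P W k)

/-- The state in which a query starts: the memory holds the index, register `0` holds the query
argument `j`, and all other registers hold `0`. -/
def start (M : List ℕ) (j : ℕ) : RAMState :=
  { pc := 0, reg := Function.update (fun _ => 0) 0 j, mem := M }

end RAMState

/-- Started on the index `M` and the argument `j`, the program `P` halts after at most `T` steps
on a RAM with words of `W` bits, with the answer `r` in register `0` and with the index intact.
The machine has no memory besides the cells of `M` and its registers. -/
def RAMAnswers (P : List RAMInstr) (W : ℕ) (M : List ℕ) (j T r : ℕ) : Prop :=
  ∃ k ≤ T, ∃ s : RAMState, RAMState.run P W k (RAMState.start M j) = some s ∧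
    P[s.pc]? = some RAMInstr.halt ∧ s.reg 0 = r ∧ s.mem = M

/-!
A smallest grammar may have a derivation tree of large height, so the index is not the grammar
itself but a balanced version of it, which is based on the symmetric centroid decomposition of
Ganardi, Jeż and Lohrey.

Give each variable the pair of `⌊log |v|⌋` and `⌊log occ v⌋`, where `occ v` counts its occurrences in
the derivation tree of the start variable. From a variable to its kids the first number decreases
weakly and the second increases weakly; as `occ v * |v| ≤ n`, both are at most `log n`. An edge along
which neither changes is a centroid edge. A variable has at most one outgoing centroid edge (two long
kids would make it twice as long) and at most one incoming one (two frequent parents would make it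
twice as frequent), so these edges form disjoint paths (`CentroidEdge.exists_split`,
`CentroidEdge.left_unique`). A kid of a run-length rule is at most a third as long as its parent, so
run-length rules never continue a path.

The string of the first variable of a path is the concatenation of the kids that hang off the path
and of the string of the last variable; the strings of the other variables on the path are infixes
of it. A search tree over this concatenation that is biased by length
(`exists_accessible_flatten`) reaches an item `x` in `O(1 + log |A| - log |x|)` steps from the root,
where `A` is the first variable. It serves the whole path: the lengths on a path agree up to a factor
of two, and a query in an infix `x` of `s x t` is a query in `s x t` from which the contribution of `s`
is removed. For fingerprints this is an affine map with coefficients that are stored with the link,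
because `c` is invertible modulo the prime `μ`. (If `c` is zero modulo `μ`, then only the first letter
matters, and `w` is replaced by a string whose index has constant size.) Along a query the costs
telescope to `O(log n)`: there are at most `2 log n` changes of path, and `log |x|` only decreases.
At a run-length rule `A → B ^ t` the fingerprint of `q ≤ t` copies of `B` is found by doubling in
`O(1 + log t)` steps, which `log |A| - log |B|` pays for.

The tree of a path has one node fewer than items, so all trees together have at most as many nodes
as the grammar has size (`RLSLP.exists_store`). `Represents.answersAt` shows that the program follows
the index correctly within the stated number of steps.
-/

/-! ### The query program -/

/-- The query program. While it runs, `R0` is the length `j` of the prefix still to be processed,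
`R1` the fingerprint of the part of the answer read so far, `R2` the power of `c` by which the
fingerprint of the rest must be multiplied, `R3` a memory address, `R4 = μ`, `R5 = 1`, `R6 = 0`,
`R12 = 2`; `R7` is scratch, `R8`, `R9`, `R10` are the exponent and the two running quantities of
the doubling loop, and `R11` is a block length. The memory layout is that of `encodeIndex`. -/
def fingerprintProgram : List RAMInstr :=
  [ -- 0: set up the constants, and point `R3` to the root link
    .const 5 1, .const 2 1, .load 4 3, .const 12 2, .arith .add 3 3 5,
    -- 5: follow the link at address `R3`, unless `j = 0`
    .jumpEq 0 6 49,
    .load 7 3, .arith .add 0 0 7, .arith .add 3 3 5,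
    .load 7 3, .arith .mul 7 7 2, .arith .add 1 1 7, .arith .mod 1 1 4, .arith .add 3 3 5,
    .load 7 3, .arith .mul 2 2 7, .arith .mod 2 2 4, .arith .add 3 3 5,
    .load 3 3,
    -- 19: read the node at address `R3`; afterwards `R3` points to its left link
    .load 11 3, .arith .add 3 3 5,
    .load 9 3, .arith .add 3 3 5,
    .load 10 3, .arith .add 3 3 5,
    .load 7 3, .arith .add 3 3 5,
    -- 27: `R8` becomes the number of blocks to skip; if all of them, take the right link
    .arith .div 8 0 11, .jumpLt 8 7 32,
    .arith .add 8 7 6, .const 7 4, .arith .add 3 3 7,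
    .arith .mul 7 8 11, .arith .sub 0 0 7,
    -- 34: append `R8` copies of the block to the answer, by repeated doubling of the block
    .jumpEq 8 6 5,
    .arith .mod 7 8 12, .jumpEq 7 6 42,
    .arith .mul 7 2 9, .arith .add 1 1 7, .arith .mod 1 1 4, .arith .mul 2 2 10, .arith .mod 2 2 4,
    .arith .mul 7 10 9, .arith .add 9 9 7, .arith .mod 9 9 4,
    .arith .mul 10 10 10, .arith .mod 10 10 4, .arith .div 8 8 12, .jump 34,
    -- 49: return the answer
    .arith .add 0 1 6, .halt ]

/-- The registers of the query program, with the constant ones filled in. -/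
def queryRegs (j acc cp e μ tmp q x y len : ℕ) : ℕ → ℕ
  | 0 => j
  | 1 => acc
  | 2 => cp
  | 3 => e
  | 4 => μ
  | 5 => 1
  | 7 => tmp
  | 8 => q
  | 9 => x
  | 10 => y
  | 11 => len
  | 12 => 2
  | _ => 0

section
variable {j acc cp e μ tmp q x y len v : ℕ}
theorem queryRegs_update_0 : Function.update (queryRegs j acc cp e μ tmp q x y len) 0 v =
    queryRegs v acc cp e μ tmp q x y len := by
  funext i; match i with | 0 | 1 | 2 | 3 | 4 | 5 | 6 | 7 | 8 | 9 | 10 | 11 | 12 | _ + 13 => rfl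
theorem queryRegs_update_1 : Function.update (queryRegs j acc cp e μ tmp q x y len) 1 v =
    queryRegs j v cp e μ tmp q x y len := by
  funext i; match i with | 0 | 1 | 2 | 3 | 4 | 5 | 6 | 7 | 8 | 9 | 10 | 11 | 12 | _ + 13 => rfl
theorem queryRegs_update_2 : Function.update (queryRegs j acc cp e μ tmp q x y len) 2 v =
    queryRegs j acc v e μ tmp q x y len := by
  funext i; match i with | 0 | 1 | 2 | 3 | 4 | 5 | 6 | 7 | 8 | 9 | 10 | 11 | 12 | _ + 13 => rfl
theorem queryRegs_update_3 : Function.update (queryRegs j acc cp e μ tmp q x y len) 3 v =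
    queryRegs j acc cp v μ tmp q x y len := by
  funext i; match i with | 0 | 1 | 2 | 3 | 4 | 5 | 6 | 7 | 8 | 9 | 10 | 11 | 12 | _ + 13 => rfl
theorem queryRegs_update_7 : Function.update (queryRegs j acc cp e μ tmp q x y len) 7 v =
    queryRegs j acc cp e μ v q x y len := by
  funext i; match i with | 0 | 1 | 2 | 3 | 4 | 5 | 6 | 7 | 8 | 9 | 10 | 11 | 12 | _ + 13 => rfl
theorem queryRegs_update_8 : Function.update (queryRegs j acc cp e μ tmp q x y len) 8 v =
    queryRegs j acc cp e μ tmp v x y len := by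
  funext i; match i with | 0 | 1 | 2 | 3 | 4 | 5 | 6 | 7 | 8 | 9 | 10 | 11 | 12 | _ + 13 => rfl
theorem queryRegs_update_9 : Function.update (queryRegs j acc cp e μ tmp q x y len) 9 v =
    queryRegs j acc cp e μ tmp q v y len := by
  funext i; match i with | 0 | 1 | 2 | 3 | 4 | 5 | 6 | 7 | 8 | 9 | 10 | 11 | 12 | _ + 13 => rfl
theorem queryRegs_update_10 : Function.update (queryRegs j acc cp e μ tmp q x y len) 10 v =
    queryRegs j acc cp e μ tmp q x v len := by
  funext i; match i with | 0 | 1 | 2 | 3 | 4 | 5 | 6 | 7 | 8 | 9 | 10 | 11 | 12 | _ + 13 => rfl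
theorem queryRegs_update_11 : Function.update (queryRegs j acc cp e μ tmp q x y len) 11 v =
    queryRegs j acc cp e μ tmp q x y v := by
  funext i; match i with | 0 | 1 | 2 | 3 | 4 | 5 | 6 | 7 | 8 | 9 | 10 | 11 | 12 | _ + 13 => rfl
end

/-- The state of the query program at program position `pc`, with memory `M`. -/
def queryState (M : List ℕ) (μ pc j acc cp e tmp q x y len : ℕ) : RAMState :=
  ⟨pc, queryRegs j acc cp e μ tmp q x y len, M⟩

/-- Started in state `s`, the program halts within `T` steps
with `r` in register `0` and memory `M`. -/
def HaltsWith (P : List RAMInstr) (W : ℕ) (M : List ℕ) (s : RAMState) (T r : ℕ) : Prop :=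
  ∃ k ≤ T, ∃ s' : RAMState, RAMState.run P W k s = some s' ∧
    P[s'.pc]? = some RAMInstr.halt ∧ s'.reg 0 = r ∧ s'.mem = M

/-! ### Symbolic execution -/

theorem run_add (P : List RAMInstr) (W k l : ℕ) (s s' : RAMState)
    (h : RAMState.run P W k s = some s') :
    RAMState.run P W (k + l) s = RAMState.run P W l s' := by
  induction k generalizing s with
  | zero => simp only [RAMState.run, Option.some.injEq] at h; simp [h]
  | succ k ih =>
    rw [Nat.succ_add]
    simp only [RAMState.run] at h ⊢
    cases hs : s.step P W with
    | none => simp [hs] at h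
    | some s1 => rw [hs] at h; exact ih s1 h

theorem HaltsWith.of_run {P : List RAMInstr} {W : ℕ} {M : List ℕ} {s s' : RAMState}
    {k T T' r : ℕ} (h : HaltsWith P W M s' T r) (hr : RAMState.run P W k s = some s')
    (hT : k + T ≤ T') : HaltsWith P W M s T' r := by
  obtain ⟨l, hl, t, h1, h2⟩ := h
  exact ⟨k + l, by omega, t, by rw [run_add P W k l s s' hr, h1], h2⟩

section
variable {P : List RAMInstr} {W k pc d a b l v : ℕ} {o : RAMOp} {reg reg' : ℕ → ℕ} {M : List ℕ}
  {s : Option RAMState}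

theorem run_const (h : P[pc]? = some (.const d v)) (hv : v < 2 ^ W)
    (hr : Function.update reg d v = reg') (hs : RAMState.run P W k ⟨pc + 1, reg', M⟩ = s) :
    RAMState.run P W (k + 1) ⟨pc, reg, M⟩ = s := by
  simp [RAMState.run, RAMState.step, h, RAMState.setReg, Nat.mod_eq_of_lt hv, hr, hs]

theorem run_arith (h : P[pc]? = some (.arith o d a b)) (hv : o.eval W (reg a) (reg b) = v)
    (hr : Function.update reg d v = reg') (hs : RAMState.run P W k ⟨pc + 1, reg', M⟩ = s) :
    RAMState.run P W (k + 1) ⟨pc, reg, M⟩ = s := by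
  simp [RAMState.run, RAMState.step, h, RAMState.setReg, hv, hr, hs]

theorem run_load (h : P[pc]? = some (.load d a)) (hv : M[reg a]? = some v)
    (hr : Function.update reg d v = reg') (hs : RAMState.run P W k ⟨pc + 1, reg', M⟩ = s) :
    RAMState.run P W (k + 1) ⟨pc, reg, M⟩ = s := by
  simp [RAMState.run, RAMState.step, h, RAMState.setReg, hv, hr, hs]

theorem run_jump (h : P[pc]? = some (.jump l)) (hs : RAMState.run P W k ⟨l, reg, M⟩ = s) :
    RAMState.run P W (k + 1) ⟨pc, reg, M⟩ = s := by
  simp [RAMState.run, RAMState.step, h, RAMState.branch, hs]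

theorem run_jumpEq_of_eq (h : P[pc]? = some (.jumpEq a b l)) (hab : reg a = reg b)
    (hs : RAMState.run P W k ⟨l, reg, M⟩ = s) : RAMState.run P W (k + 1) ⟨pc, reg, M⟩ = s := by
  simp [RAMState.run, RAMState.step, h, RAMState.branch, hab, hs]

theorem run_jumpEq_of_ne (h : P[pc]? = some (.jumpEq a b l)) (hab : reg a ≠ reg b)
    (hs : RAMState.run P W k ⟨pc + 1, reg, M⟩ = s) :
    RAMState.run P W (k + 1) ⟨pc, reg, M⟩ = s := by
  simp [RAMState.run, RAMState.step, h, RAMState.branch, hab, hs]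

theorem run_jumpLt_of_lt (h : P[pc]? = some (.jumpLt a b l)) (hab : reg a < reg b)
    (hs : RAMState.run P W k ⟨l, reg, M⟩ = s) : RAMState.run P W (k + 1) ⟨pc, reg, M⟩ = s := by
  simp [RAMState.run, RAMState.step, h, RAMState.branch, hab, hs]

theorem run_jumpLt_of_le (h : P[pc]? = some (.jumpLt a b l)) (hab : reg b ≤ reg a)
    (hs : RAMState.run P W k ⟨pc + 1, reg, M⟩ = s) :
    RAMState.run P W (k + 1) ⟨pc, reg, M⟩ = s := by
  simp [RAMState.run, RAMState.step, h, RAMState.branch, Nat.not_lt.2 hab, hs]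
end

/-- Following a link with cells `sh`, `nh`, `mu'`, `p`: the prefix grows by `sh`, and the affine map
from the fingerprint still to come to the answer is composed with that of the link. -/
theorem run_follow_edge {M : List ℕ} {W μ j acc cp e tmp q x y len sh nh mu' p : ℕ}
    (hj : j ≠ 0) (h0 : M[e]? = some sh) (h1 : M[e + 1]? = some nh) (h2 : M[e + 2]? = some mu')
    (h3 : M[e + 3]? = some p) (he : e + 3 < 2 ^ W) (hjs : j + sh < 2 ^ W)
    (hacc : acc < μ) (hcp : cp < μ) (hnh : nh < μ) (hmu : mu' < μ) (hμ : μ * μ < 2 ^ W) :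
    ∃ tmp', RAMState.run fingerprintProgram W 14 (queryState M μ 5 j acc cp e tmp q x y len) =
      some (queryState M μ 19 (j + sh) ((acc + nh * cp) % μ) (cp * mu' % μ) p tmp' q x y len) := by
  have a1 : nh * cp < 2 ^ W := (Nat.mul_lt_mul'' hnh hcp).trans hμ
  have a2 : cp * mu' < 2 ^ W := (Nat.mul_lt_mul'' hcp hmu).trans hμ
  have a3 : acc + nh * cp < 2 ^ W := by nlinarith
  have a4 : (acc + nh * cp) % μ < 2 ^ W := (Nat.mod_le _ _).trans_lt a3
  have a5 : cp * mu' % μ < 2 ^ W := (Nat.mod_le _ _).trans_lt a2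
  have e1 : (e + 1) % 2 ^ W = e + 1 := Nat.mod_eq_of_lt (by omega)
  have e2 : (e + 1 + 1) % 2 ^ W = e + 2 := Nat.mod_eq_of_lt (by omega)
  have e3 : (e + 2 + 1) % 2 ^ W = e + 3 := Nat.mod_eq_of_lt (by omega)
  refine ⟨mu', ?_⟩
  refine run_jumpEq_of_ne rfl hj ?_
  refine run_load rfl h0 queryRegs_update_7 ?_
  refine run_arith rfl (Nat.mod_eq_of_lt hjs) queryRegs_update_0 ?_
  refine run_arith rfl e1 queryRegs_update_3 ?_
  refine run_load rfl h1 queryRegs_update_7 ?_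
  refine run_arith rfl (Nat.mod_eq_of_lt a1) queryRegs_update_7 ?_
  refine run_arith rfl (Nat.mod_eq_of_lt a3) queryRegs_update_1 ?_
  refine run_arith rfl (Nat.mod_eq_of_lt a4) queryRegs_update_1 ?_
  refine run_arith rfl e2 queryRegs_update_3 ?_
  refine run_load rfl h2 queryRegs_update_7 ?_
  refine run_arith rfl (Nat.mod_eq_of_lt a2) queryRegs_update_2 ?_
  refine run_arith rfl (Nat.mod_eq_of_lt a5) queryRegs_update_2 ?_
  refine run_arith rfl e3 queryRegs_update_3 ?_
  refine run_load rfl h3 queryRegs_update_3 ?_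
  rfl

/-- Subtraction of words does not wrap around when the difference is nonnegative. -/
theorem sub_eval_of_le {W a b : ℕ} (h : b ≤ a) (ha : a < 2 ^ W) :
    (a + (2 ^ W - b)) % 2 ^ W = a - b := by
  rw [show a + (2 ^ W - b) = (a - b) + 2 ^ W by omega, Nat.add_mod_right,
    Nat.mod_eq_of_lt (by omega)]

/-- At a node whose prefix ends within the copies of the block, the left link is chosen. -/
theorem run_node_left {M : List ℕ} {W μ j acc cp p tmp q x y len ℓ κ b t : ℕ}
    (h0 : M[p]? = some ℓ) (h1 : M[p + 1]? = some κ) (h2 : M[p + 2]? = some b)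
    (h3 : M[p + 3]? = some t) (hp : p + 4 < 2 ^ W) (hj : j < 2 ^ W) (ht : j / ℓ < t) :
    ∃ tmp', RAMState.run fingerprintProgram W 12 (queryState M μ 19 j acc cp p tmp q x y len) =
      some (queryState M μ 34 (j % ℓ) acc cp (p + 4) tmp' (j / ℓ) κ b ℓ) := by
  have e1 : (p + 1) % 2 ^ W = p + 1 := Nat.mod_eq_of_lt (by omega)
  have e2 : (p + 1 + 1) % 2 ^ W = p + 2 := Nat.mod_eq_of_lt (by omega)
  have e3 : (p + 2 + 1) % 2 ^ W = p + 3 := Nat.mod_eq_of_lt (by omega)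
  have e4 : (p + 3 + 1) % 2 ^ W = p + 4 := Nat.mod_eq_of_lt (by omega)
  have a1 : j / ℓ % 2 ^ W = j / ℓ := Nat.mod_eq_of_lt ((Nat.div_le_self _ _).trans_lt hj)
  have a2 : j / ℓ * ℓ ≤ j := Nat.div_mul_le_self j ℓ
  have a3 : j / ℓ * ℓ % 2 ^ W = j / ℓ * ℓ := Nat.mod_eq_of_lt (by omega)
  have a4 : j - j / ℓ * ℓ = j % ℓ := by rw [Nat.mod_eq_sub_div_mul]
  refine ⟨j / ℓ * ℓ, ?_⟩
  refine run_load rfl h0 queryRegs_update_11 ?_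
  refine run_arith rfl e1 queryRegs_update_3 ?_
  refine run_load rfl h1 queryRegs_update_9 ?_
  refine run_arith rfl e2 queryRegs_update_3 ?_
  refine run_load rfl h2 queryRegs_update_10 ?_
  refine run_arith rfl e3 queryRegs_update_3 ?_
  refine run_load rfl h3 queryRegs_update_7 ?_
  refine run_arith rfl e4 queryRegs_update_3 ?_
  refine run_arith rfl a1 queryRegs_update_8 ?_
  refine run_jumpLt_of_lt rfl ht ?_
  refine run_arith rfl a3 queryRegs_update_7 ?_
  refine run_arith rfl ((sub_eval_of_le a2 hj).trans a4) queryRegs_update_0 ?_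
  rfl

/-- At a node whose prefix contains all `t` copies of the block, the right link is chosen. -/
theorem run_node_right {M : List ℕ} {W μ j acc cp p tmp q x y len ℓ κ b t : ℕ}
    (h0 : M[p]? = some ℓ) (h1 : M[p + 1]? = some κ) (h2 : M[p + 2]? = some b)
    (h3 : M[p + 3]? = some t) (hp : p + 8 < 2 ^ W) (hj : j < 2 ^ W) (ht : t ≤ j / ℓ) :
    ∃ tmp', RAMState.run fingerprintProgram W 15 (queryState M μ 19 j acc cp p tmp q x y len) =
      some (queryState M μ 34 (j - t * ℓ) acc cp (p + 8) tmp' t κ b ℓ) := by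
  have e1 : (p + 1) % 2 ^ W = p + 1 := Nat.mod_eq_of_lt (by omega)
  have e2 : (p + 1 + 1) % 2 ^ W = p + 2 := Nat.mod_eq_of_lt (by omega)
  have e3 : (p + 2 + 1) % 2 ^ W = p + 3 := Nat.mod_eq_of_lt (by omega)
  have e4 : (p + 3 + 1) % 2 ^ W = p + 4 := Nat.mod_eq_of_lt (by omega)
  have e5 : 4 < 2 ^ W := by omega
  have e6 : (p + 4 + 4) % 2 ^ W = p + 8 := Nat.mod_eq_of_lt (by omega)
  have a1 : j / ℓ % 2 ^ W = j / ℓ := Nat.mod_eq_of_lt ((Nat.div_le_self _ _).trans_lt hj)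
  have a0 : t % 2 ^ W = t :=
    Nat.mod_eq_of_lt ((ht.trans (Nat.div_le_self _ _)).trans_lt hj)
  have a2 : t * ℓ ≤ j := (Nat.mul_le_mul_right _ ht).trans (Nat.div_mul_le_self j ℓ)
  have a3 : t * ℓ % 2 ^ W = t * ℓ := Nat.mod_eq_of_lt (by omega)
  refine ⟨t * ℓ, ?_⟩
  refine run_load rfl h0 queryRegs_update_11 ?_
  refine run_arith rfl e1 queryRegs_update_3 ?_
  refine run_load rfl h1 queryRegs_update_9 ?_
  refine run_arith rfl e2 queryRegs_update_3 ?_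
  refine run_load rfl h2 queryRegs_update_10 ?_
  refine run_arith rfl e3 queryRegs_update_3 ?_
  refine run_load rfl h3 queryRegs_update_7 ?_
  refine run_arith rfl e4 queryRegs_update_3 ?_
  refine run_arith rfl a1 queryRegs_update_8 ?_
  refine run_jumpLt_of_le rfl ht ?_
  refine run_arith rfl a0 queryRegs_update_8 ?_
  refine run_const rfl e5 queryRegs_update_7 ?_
  refine run_arith rfl e6 queryRegs_update_3 ?_
  refine run_arith rfl a3 queryRegs_update_7 ?_
  refine run_arith rfl (sub_eval_of_le a2 hj) queryRegs_update_0 ?_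
  rfl

theorem run_loop_even {M : List ℕ} {W μ j acc cp e tmp q x y len : ℕ}
    (hq : q ≠ 0) (hqW : q < 2 ^ W) (hx : x < μ) (hy : y < μ) (hμ : μ * μ < 2 ^ W)
    (hodd : q % 2 = 0) :
    ∃ tmp', RAMState.run fingerprintProgram W 10 (queryState M μ 34 j acc cp e tmp q x y len) =
      some (queryState M μ 34 j acc cp e tmp' (q / 2) ((x + y * x) % μ) (y * y % μ) len) := by
  have b1 : y * x < 2 ^ W := (Nat.mul_lt_mul'' hy hx).trans hμ
  have b2 : x + y * x < 2 ^ W := by nlinarith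
  have b3 : y * y < 2 ^ W := (Nat.mul_lt_mul'' hy hy).trans hμ
  have b4 : (x + y * x) % μ < 2 ^ W := (Nat.mod_le _ _).trans_lt b2
  have b5 : y * y % μ < 2 ^ W := (Nat.mod_le _ _).trans_lt b3
  have b6 : q / 2 < 2 ^ W := (Nat.div_le_self _ _).trans_lt hqW
  have c1 : q % 2 % 2 ^ W = 0 := by simp [hodd]
  refine ⟨y * x, ?_⟩
  refine run_jumpEq_of_ne rfl hq ?_
  refine run_arith rfl c1 queryRegs_update_7 ?_
  refine run_jumpEq_of_eq rfl rfl ?_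
  refine run_arith rfl (Nat.mod_eq_of_lt b1) queryRegs_update_7 ?_
  refine run_arith rfl (Nat.mod_eq_of_lt b2) queryRegs_update_9 ?_
  refine run_arith rfl (Nat.mod_eq_of_lt b4) queryRegs_update_9 ?_
  refine run_arith rfl (Nat.mod_eq_of_lt b3) queryRegs_update_10 ?_
  refine run_arith rfl (Nat.mod_eq_of_lt b5) queryRegs_update_10 ?_
  refine run_arith rfl (Nat.mod_eq_of_lt b6) queryRegs_update_8 ?_
  refine run_jump rfl ?_
  rfl

theorem run_loop_odd {M : List ℕ} {W μ j acc cp e tmp q x y len : ℕ}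
    (hqW : q < 2 ^ W) (hx : x < μ) (hy : y < μ) (hacc : acc < μ) (hcp : cp < μ)
    (hμ : μ * μ < 2 ^ W) (hW : 1 < 2 ^ W) (hodd : q % 2 = 1) :
    ∃ tmp', RAMState.run fingerprintProgram W 15 (queryState M μ 34 j acc cp e tmp q x y len) =
      some (queryState M μ 34 j ((acc + cp * x) % μ) (cp * y % μ) e tmp' (q / 2)
        ((x + y * x) % μ) (y * y % μ) len) := by
  have hq : q ≠ 0 := by rintro rfl; simp at hodd
  have b1 : y * x < 2 ^ W := (Nat.mul_lt_mul'' hy hx).trans hμ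
  have b2 : x + y * x < 2 ^ W := by nlinarith
  have b3 : y * y < 2 ^ W := (Nat.mul_lt_mul'' hy hy).trans hμ
  have b4 : (x + y * x) % μ < 2 ^ W := (Nat.mod_le _ _).trans_lt b2
  have b5 : y * y % μ < 2 ^ W := (Nat.mod_le _ _).trans_lt b3
  have b6 : q / 2 < 2 ^ W := (Nat.div_le_self _ _).trans_lt hqW
  have c1 : cp * x < 2 ^ W := (Nat.mul_lt_mul'' hcp hx).trans hμ
  have c2 : acc + cp * x < 2 ^ W := by nlinarith
  have c3 : cp * y < 2 ^ W := (Nat.mul_lt_mul'' hcp hy).trans hμ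
  have c4 : (acc + cp * x) % μ < 2 ^ W := (Nat.mod_le _ _).trans_lt c2
  have c5 : cp * y % μ < 2 ^ W := (Nat.mod_le _ _).trans_lt c3
  have c6 : q % 2 % 2 ^ W = 1 := by rw [hodd, Nat.mod_eq_of_lt hW]
  refine ⟨y * x, ?_⟩
  refine run_jumpEq_of_ne rfl hq ?_
  refine run_arith rfl c6 queryRegs_update_7 ?_
  refine run_jumpEq_of_ne rfl one_ne_zero ?_
  refine run_arith rfl (Nat.mod_eq_of_lt c1) queryRegs_update_7 ?_
  refine run_arith rfl (Nat.mod_eq_of_lt c2) queryRegs_update_1 ?_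
  refine run_arith rfl (Nat.mod_eq_of_lt c4) queryRegs_update_1 ?_
  refine run_arith rfl (Nat.mod_eq_of_lt c3) queryRegs_update_2 ?_
  refine run_arith rfl (Nat.mod_eq_of_lt c5) queryRegs_update_2 ?_
  refine run_arith rfl (Nat.mod_eq_of_lt b1) queryRegs_update_7 ?_
  refine run_arith rfl (Nat.mod_eq_of_lt b2) queryRegs_update_9 ?_
  refine run_arith rfl (Nat.mod_eq_of_lt b4) queryRegs_update_9 ?_
  refine run_arith rfl (Nat.mod_eq_of_lt b3) queryRegs_update_10 ?_
  refine run_arith rfl (Nat.mod_eq_of_lt b5) queryRegs_update_10 ?_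
  refine run_arith rfl (Nat.mod_eq_of_lt b6) queryRegs_update_8 ?_
  refine run_jump rfl ?_
  rfl

theorem run_loop_exit {M : List ℕ} {W μ j acc cp e tmp x y len : ℕ} :
    RAMState.run fingerprintProgram W 1 (queryState M μ 34 j acc cp e tmp 0 x y len) =
      some (queryState M μ 5 j acc cp e tmp 0 x y len) :=
  run_jumpEq_of_eq rfl rfl rfl

theorem halts_of_zero {M : List ℕ} {W μ acc cp e tmp q x y len T : ℕ} (hacc : acc < 2 ^ W)
    (hT : 2 ≤ T) :
    HaltsWith fingerprintProgram W M (queryState M μ 5 0 acc cp e tmp q x y len) T acc := by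
  refine ⟨2, hT, queryState M μ 50 acc acc cp e tmp q x y len, ?_, by rfl, by rfl, by rfl⟩
  exact run_jumpEq_of_eq rfl rfl (run_arith rfl (Nat.mod_eq_of_lt hacc) queryRegs_update_0 rfl)

theorem run_start {M : List ℕ} {W μ j : ℕ} (h0 : M[0]? = some μ) (hW : 2 < 2 ^ W) :
    RAMState.run fingerprintProgram W 5 (RAMState.start M j) =
      some (queryState M μ 5 j 0 1 1 0 0 0 0 0) := by
  refine run_const rfl (by omega) rfl ?_
  refine run_const rfl (by omega) rfl ?_
  refine run_load rfl h0 rfl ?_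
  refine run_const rfl hW rfl ?_
  refine run_arith rfl (Nat.mod_eq_of_lt (by omega : 0 + 1 < 2 ^ W)) rfl ?_
  refine congrArg some (congrArg (RAMState.mk 5 · M) (funext fun i => ?_))
  match i with
  | 0 | 1 | 2 | 3 | 4 | 5 | 6 | 7 | 8 | 9 | 10 | 11 | 12 => rfl
  | i + 13 => rfl

theorem sum_pow_two_mul {R : Type*} [CommRing R] (y : R) (m : ℕ) :
    ∑ i ∈ Finset.range (2 * m), y ^ i = (1 + y) * ∑ i ∈ Finset.range m, (y * y) ^ i := by
  induction m with
  | zero => simp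
  | succ m ih =>
    rw [Nat.mul_succ, Finset.sum_range_succ, Finset.sum_range_succ, ih, Finset.sum_range_succ]
    ring

theorem sum_pow_two_mul_add_one {R : Type*} [CommRing R] (y : R) (m : ℕ) :
    ∑ i ∈ Finset.range (2 * m + 1), y ^ i =
      1 + y * (1 + y) * ∑ i ∈ Finset.range m, (y * y) ^ i := by
  rw [Finset.sum_range_succ', mul_assoc, ← sum_pow_two_mul, Finset.mul_sum]
  simp [pow_succ', add_comm]

/-- The doubling loop appends to the answer `q` copies of a string with fingerprint `x`, where `y`
is the power of `c` for its length. No inverse is used, so it does not matter whether `y = 1`. -/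
theorem run_loop {M : List ℕ} {W μ j e len : ℕ} (hμ0 : 0 < μ) (hμ : μ * μ < 2 ^ W)
    (hW : 1 < 2 ^ W) (q : ℕ) : ∀ acc cp tmp x y : ℕ, q < 2 ^ W → acc < μ → cp < μ → x < μ → y < μ →
    ∃ k ≤ 15 * Nat.log 2 (2 * q) + 1, ∃ acc' cp' tmp' x' y',
      RAMState.run fingerprintProgram W k (queryState M μ 34 j acc cp e tmp q x y len) =
        some (queryState M μ 5 j acc' cp' e tmp' 0 x' y' len) ∧ acc' < μ ∧ cp' < μ ∧
      (acc' : ZMod μ) = acc + cp * (x * ∑ i ∈ Finset.range q, (y : ZMod μ) ^ i) ∧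
      (cp' : ZMod μ) = cp * y ^ q := by
  induction q using Nat.strong_induction_on with
  | _ q ih =>
    intro acc cp tmp x y hq hacc hcp hx hy
    rcases Nat.eq_zero_or_pos q with rfl | hq0
    · exact ⟨1, by omega, acc, cp, tmp, x, y, run_loop_exit, hacc, hcp, by simp, by simp⟩
    have hlog : Nat.log 2 (2 * (q / 2)) + 1 ≤ Nat.log 2 (2 * q) := by
      rw [mul_comm 2 q, Nat.log_mul_base one_lt_two hq0.ne']
      exact Nat.succ_le_succ (Nat.log_mono_right (Nat.mul_div_le q 2))
    have hx' : (x + y * x) % μ < μ := Nat.mod_lt _ hμ0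
    have hy' : y * y % μ < μ := Nat.mod_lt _ hμ0
    have hlt : q / 2 < q := Nat.div_lt_self hq0 one_lt_two
    rcases Nat.mod_two_eq_zero_or_one q with h2 | h2
    · obtain ⟨t1, h1⟩ := run_loop_even (M := M) (j := j) (acc := acc) (cp := cp) (e := e)
        (tmp := tmp) (len := len) hq0.ne' hq hx hy hμ h2
      obtain ⟨k, hk, acc', cp', t', x', y', hr, ha, hc, hae, hce⟩ :=
        ih (q / 2) hlt acc cp t1 _ _ (hlt.trans hq) hacc hcp hx' hy'
      refine ⟨10 + k, by omega, acc', cp', t', x', y', by rw [run_add _ _ _ _ _ _ h1, hr],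
        ha, hc, ?_, ?_⟩
      · obtain ⟨m, rfl⟩ : ∃ m, q = 2 * m := ⟨q / 2, by omega⟩
        rw [hae, sum_pow_two_mul, Nat.mul_div_cancel_left m two_pos]
        push_cast [ZMod.natCast_mod]
        ring
      · obtain ⟨m, rfl⟩ : ∃ m, q = 2 * m := ⟨q / 2, by omega⟩
        rw [hce, Nat.mul_div_cancel_left m two_pos, pow_mul]
        push_cast [ZMod.natCast_mod]
        ring
    · obtain ⟨t1, h1⟩ := run_loop_odd (M := M) (j := j) (acc := acc) (cp := cp) (e := e)
        (tmp := tmp) (len := len) hq hx hy hacc hcp hμ hW h2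
      obtain ⟨k, hk, acc', cp', t', x', y', hr, ha, hc, hae, hce⟩ :=
        ih (q / 2) hlt _ _ t1 _ _ (hlt.trans hq) (Nat.mod_lt (acc + cp * x) hμ0)
          (Nat.mod_lt (cp * y) hμ0) hx' hy'
      obtain ⟨m, rfl⟩ : ∃ m, q = 2 * m + 1 := ⟨q / 2, by omega⟩
      have hm : (2 * m + 1) / 2 = m := by omega
      refine ⟨15 + k, by omega, acc', cp', t', x', y', by rw [run_add _ _ _ _ _ _ h1, hr],
        ha, hc, ?_, ?_⟩
      · rw [hae, sum_pow_two_mul_add_one, hm]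
        push_cast [ZMod.natCast_mod]
        ring
      · rw [hce, hm, pow_succ, pow_mul]
        push_cast [ZMod.natCast_mod]
        ring

/-! ### Fingerprints -/

/-- The Karp-Rabin fingerprint as a polynomial value in a commutative ring. -/
def fingerprint {R : Type*} [CommRing R] (c : R) : List ℕ → R
  | [] => 0
  | a :: x => a + c * fingerprint c x

section
variable {R : Type*} [CommRing R] (c : R)

theorem fingerprint_append (x y : List ℕ) :
    fingerprint c (x ++ y) = fingerprint c x + c ^ x.length * fingerprint c y := by
  induction x with
  | nil => simp [fingerprint]
  | cons a x ih => simp only [List.cons_append, fingerprint, ih, List.length_cons, pow_succ]; ring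

theorem fingerprint_replicate_flatten (x : List ℕ) (q : ℕ) :
    fingerprint c (List.replicate q x).flatten =
      fingerprint c x * ∑ i ∈ Finset.range q, (c ^ x.length) ^ i := by
  induction q with
  | zero => simp [fingerprint]
  | succ q ih =>
    rw [List.replicate_succ, List.flatten_cons, fingerprint_append, ih, Finset.sum_range_succ',
      mul_add, Finset.mul_sum, Finset.mul_sum, Finset.mul_sum]
    simp only [pow_succ, pow_zero, mul_one]
    rw [add_comm]
    congr 1
    refine Finset.sum_congr rfl fun i _ => ?_
    ring

theorem fingerprint_eq_sum (x : List ℕ) :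
    fingerprint c x = ∑ i : Fin x.length, (x.get i : R) * c ^ (i : ℕ) := by
  induction x with
  | nil => simp [fingerprint]
  | cons a x ih =>
    rw [fingerprint, ih, Finset.mul_sum]
    simp only [List.length_cons]
    rw [Fin.sum_univ_succ]
    simp only [List.get_cons_zero, Fin.val_zero, pow_zero, mul_one, Fin.val_succ, pow_succ]
    congr 1
    refine Finset.sum_congr rfl fun i _ => ?_
    rw [show (a :: x).get i.succ = x.get i from rfl]
    ring
end

theorem karpRabin_eq (c : ℤ) (μ : ℕ) [NeZero μ] (x : List ℕ) :
    karpRabin c μ x = (fingerprint (c : ZMod μ) x).val := by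
  have h0 : (0 : ℤ) ≤ (∑ i : Fin x.length, (x.get i : ℤ) * c ^ (i : ℕ)) % (μ : ℤ) :=
    Int.emod_nonneg _ (by exact_mod_cast NeZero.ne μ)
  have h1 : fingerprint (c : ZMod μ) x =
      ((∑ i : Fin x.length, (x.get i : ℤ) * c ^ (i : ℕ) : ℤ) : ZMod μ) := by
    rw [fingerprint_eq_sum]; push_cast; rfl
  zify
  rw [karpRabin, Int.toNat_of_nonneg h0, h1, ZMod.val_intCast]

/-! ### The index -/

/-- A reference to a string `x` that occurs in the string of another node: the number of that node,
and the string `skip` that precedes this occurrence of `x`. -/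
structure Link where
  node : ℕ
  skip : List ℕ

/-- A node of the index. Its string starts with `reps` copies of `block`; the link `left` refers to
`block`, and `right` to the rest of the string. A link that no query follows may be arbitrary.
Strings occur here only for reasoning: the encoding keeps their lengths and fingerprints. -/
structure IndexNode where
  block : List ℕ
  reps : ℕ
  left : Link
  right : Link

/-- `Represents B M p x d`: node `p` of the store `M` has the string `x`, of length at most `B`, and
`d` bounds the cost of a query in it. A query costs one unit per node, and `1 + log t` more
at a node that repeats its block `t` times. A link may lead to a longer string, of
which `x` is only an infix. -/
inductive Represents (B : ℕ) (M : List IndexNode) : ℕ → List ℕ → ℕ → Prop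
  | letter {p : ℕ} {nd : IndexNode} {a : ℕ} (hp : M[p]? = some nd) (hblock : nd.block = [a])
      (hreps : nd.reps = 1) (hB : 1 ≤ B) : Represents B M p [a] 1
  | power {p : ℕ} {nd : IndexNode} {x post : List ℕ} {t d : ℕ} (hp : M[p]? = some nd)
      (hblock : nd.block = x) (hx : x ≠ []) (hreps : nd.reps = t) (ht : 1 ≤ t)
      (hB : (List.replicate t x).flatten.length ≤ B)
      (hleft : Represents B M nd.left.node (nd.left.skip ++ x ++ post) d) :
      Represents B M p (List.replicate t x).flatten (d + 2 + Nat.log 2 t)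
  | append {p : ℕ} {nd : IndexNode} {x y post post' : List ℕ} {d d₁ d₂ : ℕ}
      (hp : M[p]? = some nd) (hblock : nd.block = x) (hx : x ≠ []) (hreps : nd.reps = 1)
      (hB : (x ++ y).length ≤ B)
      (hleft : Represents B M nd.left.node (nd.left.skip ++ x ++ post) d₁)
      (hright : Represents B M nd.right.node (nd.right.skip ++ y ++ post') d₂)
      (h₁ : d₁ < d) (h₂ : d₂ < d) :
      Represents B M p (x ++ y) d

theorem Represents.length_le {B : ℕ} {M : List IndexNode} {p d : ℕ} {x : List ℕ}
    (h : Represents B M p x d) : x.length ≤ B := by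
  cases h with
  | letter _ _ _ hB => simpa using hB
  | power _ _ _ _ _ hB => exact hB
  | append _ _ _ _ hB => exact hB

theorem Represents.mono {B : ℕ} {M : List IndexNode} (N : List IndexNode) {p d : ℕ} {x : List ℕ}
    (h : Represents B M p x d) : Represents B (M ++ N) p x d := by
  have key : ∀ {p : ℕ} {nd : IndexNode}, M[p]? = some nd → (M ++ N)[p]? = some nd := by
    intro p nd h
    rw [List.getElem?_append_left (List.getElem?_eq_some_iff.1 h).1, h]
  induction h with
  | letter hp hblock hreps hB => exact .letter (key hp) hblock hreps hB
  | power hp hblock hx hreps ht hB _ ih => exact .power (key hp) hblock hx hreps ht hB ih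
  | append hp hblock hx hreps hB _ _ h₁ h₂ ih₁ ih₂ =>
    exact .append (key hp) hblock hx hreps hB ih₁ ih₂ h₁ h₂

theorem Represents.lt_length {B : ℕ} {M : List IndexNode} {p d : ℕ} {x : List ℕ}
    (h : Represents B M p x d) : p < M.length := by
  cases h with
  | letter hp => exact (List.getElem?_eq_some_iff.1 hp).1
  | power hp => exact (List.getElem?_eq_some_iff.1 hp).1
  | append hp => exact (List.getElem?_eq_some_iff.1 hp).1

section encode
variable {μ : ℕ} (c : ZMod μ)

/-- The four cells of a link. If `s` is the skipped string and `x` the string referred to, then the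
fingerprint of `x` is recovered from that of `s ++ x` by an affine map whose coefficients are the
second and third cell; this needs `c ≠ 0`. The last cell is the address of the node. -/
def Link.encode (e : Link) : List ℕ :=
  [e.skip.length, (-(c⁻¹ ^ e.skip.length * fingerprint c e.skip)).val,
    (c⁻¹ ^ e.skip.length).val, 12 * e.node + 5]

/-- The twelve cells of a node. -/
def IndexNode.encode (nd : IndexNode) : List ℕ :=
  [nd.block.length, (fingerprint c nd.block).val, (c ^ nd.block.length).val, nd.reps] ++
    (nd.left.encode c ++ nd.right.encode c)

/-- The memory: the modulus, the link to the whole string at address `1`, and the nodes, of which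
number `p` starts at address `12 * p + 5`. -/
def encodeIndex (root : Link) (M : List IndexNode) : List ℕ :=
  μ :: (root.encode c ++ M.flatMap (IndexNode.encode c))

theorem IndexNode.length_encode (nd : IndexNode) : (nd.encode c).length = 12 := rfl

theorem length_encodeIndex (root : Link) (M : List IndexNode) :
    (encodeIndex c root M).length = 12 * M.length + 5 := by
  simp [encodeIndex, Link.encode, List.length_flatMap, IndexNode.length_encode, mul_comm]

theorem getElem?_flatMap_encode {M : List IndexNode} {p : ℕ} {nd : IndexNode}
    (hp : M[p]? = some nd) {i : ℕ} (hi : i < 12) :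
    (M.flatMap (IndexNode.encode c))[12 * p + i]? = (nd.encode c)[i]? := by
  induction M generalizing p with
  | nil => simp at hp
  | cons m M ih =>
    rw [List.flatMap_cons]
    cases p with
    | zero =>
      simp only [List.getElem?_cons_zero, Option.some.injEq] at hp
      subst hp
      rw [List.getElem?_append_left (by rw [IndexNode.length_encode]; omega)]
      simp
    | succ p =>
      rw [List.getElem?_append_right (by rw [IndexNode.length_encode]; omega),
        IndexNode.length_encode, ← ih (by simpa using hp)]
      congr 1
      omega

theorem getElem?_encodeIndex (root : Link) {M : List IndexNode} {p : ℕ} {nd : IndexNode}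
    (hp : M[p]? = some nd) {i : ℕ} (hi : i < 12) :
    (encodeIndex c root M)[12 * p + 5 + i]? = (nd.encode c)[i]? := by
  rw [← getElem?_flatMap_encode c hp hi, encodeIndex,
    show 12 * p + 5 + i = (12 * p + i + 4) + 1 by omega, List.getElem?_cons_succ,
    List.getElem?_append_right (by simp [Link.encode])]
  simp [Link.encode]

/-- The cells of the link `e` are found at address `addr`. -/
def Link.StoredAt (e : Link) (M : List ℕ) (addr : ℕ) : Prop :=
  ∀ i < 4, M[addr + i]? = (e.encode c)[i]?

variable {c}

theorem link_storedAt_left {root : Link} {M : List IndexNode} {p : ℕ} {nd : IndexNode} (hp : M[p]? = some nd) :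
    nd.left.StoredAt c (encodeIndex c root M) (12 * p + 9) := by
  intro i hi
  rw [show 12 * p + 9 + i = 12 * p + 5 + (4 + i) by omega,
    getElem?_encodeIndex c root hp (by omega)]
  interval_cases i <;> rfl

theorem link_storedAt_right {root : Link} {M : List IndexNode} {p : ℕ} {nd : IndexNode} (hp : M[p]? = some nd) :
    nd.right.StoredAt c (encodeIndex c root M) (12 * p + 13) := by
  intro i hi
  rw [show 12 * p + 13 + i = 12 * p + 5 + (8 + i) by omega,
    getElem?_encodeIndex c root hp (by omega)]
  interval_cases i <;> rfl

theorem link_storedAt_root {root : Link} {M : List IndexNode} : root.StoredAt c (encodeIndex c root M) 1 := by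
  intro i hi
  interval_cases i <;> rfl

end encode

/-! ### Correctness of queries -/

theorem halts_of_zero_val {M : List ℕ} {W μ acc cp e tmp q x y len T : ℕ} (hacc : acc < μ)
    (hμ : μ * μ < 2 ^ W) (hT : 2 ≤ T) {v : ZMod μ} (hv : v = acc) :
    HaltsWith fingerprintProgram W M (queryState M μ 5 0 acc cp e tmp q x y len) T v.val := by
  rw [hv, ZMod.val_natCast_of_lt hacc]
  exact halts_of_zero (by nlinarith) hT

theorem take_replicate_flatten {x : List ℕ} {t j : ℕ} (ht : j / x.length < t) :
    (List.replicate t x).flatten.take j =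
      (List.replicate (j / x.length) x).flatten ++ x.take (j % x.length) := by
  obtain ⟨s, rfl⟩ : ∃ s, t = j / x.length + (1 + s) := ⟨t - j / x.length - 1, by omega⟩
  rcases Nat.eq_zero_or_pos x.length with h0 | hpos
  · have : x = [] := List.length_eq_zero_iff.1 h0
    subst this
    simp
  have hj := Nat.div_add_mod' j x.length
  have hlt := Nat.mod_lt j hpos
  generalize j / x.length = a at *
  generalize j % x.length = b at *
  have hlen : (List.replicate a x).flatten.length = a * x.length := by simp
  rw [← hj, ← hlen, List.replicate_add, List.replicate_add, List.flatten_append,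
    List.flatten_append, List.take_length_add_append, List.take_append_of_le_length]
  · simp
  · simpa using hlt.le

section correctness
variable {μ : ℕ} [Fact μ.Prime] {c : ZMod μ} {W B : ℕ} {root : Link} {M : List IndexNode}

/-- Started at node `p`, the program computes the contribution of every prefix of `x` to the
answer within `45 * d + 2` steps. -/
def AnswersAt (c : ZMod μ) (W : ℕ) (root : Link) (M : List IndexNode) (p : ℕ) (x : List ℕ)
    (d : ℕ) : Prop :=
  ∀ j ≤ x.length, ∀ acc cp tmp q y z len, acc < μ → cp < μ →
    HaltsWith fingerprintProgram W (encodeIndex c root M)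
      (queryState (encodeIndex c root M) μ 19 j acc cp (12 * p + 5) tmp q y z len) (45 * d + 2)
      (acc + cp * fingerprint c (x.take j) : ZMod μ).val

theorem AnswersAt.halts_follow (hc : c ≠ 0) (hμ : μ * μ < 2 ^ W) (hB : B < 2 ^ W) {e : Link}
    {addr d : ℕ} {x post : List ℕ} (hst : e.StoredAt c (encodeIndex c root M) addr)
    (haddr : addr + 3 < 2 ^ W) (h : AnswersAt c W root M e.node (e.skip ++ x ++ post) d)
    (hlen : (e.skip ++ x ++ post).length ≤ B) {j : ℕ} (hj : j ≤ x.length)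
    {acc cp tmp q y z len : ℕ} (hacc : acc < μ) (hcp : cp < μ) :
    HaltsWith fingerprintProgram W (encodeIndex c root M)
      (queryState (encodeIndex c root M) μ 5 j acc cp addr tmp q y z len) (45 * d + 16)
      (acc + cp * fingerprint c (x.take j) : ZMod μ).val := by
  have hμ0 : 0 < μ := (Fact.out : μ.Prime).pos
  rcases Nat.eq_zero_or_pos j with rfl | hj0
  · exact halts_of_zero_val hacc hμ (by omega) (by simp [fingerprint])
  simp only [List.length_append] at hlen
  obtain ⟨tmp', hr⟩ := run_follow_edge (e := addr) (W := W) (μ := μ) (j := j) (acc := acc) (cp := cp)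
    (tmp := tmp) (q := q) (x := y) (y := z) (len := len) hj0.ne' (hst 0 (by omega))
    (hst 1 (by omega)) (hst 2 (by omega)) (hst 3 (by omega)) haddr (by omega) hacc hcp
    (ZMod.val_lt _) (ZMod.val_lt _) hμ
  have := h (j + e.skip.length) (by simp; omega) _ _ tmp' q y z len
    (Nat.mod_lt (acc + (-(c⁻¹ ^ e.skip.length * fingerprint c e.skip)).val * cp) hμ0)
    (Nat.mod_lt (cp * (c⁻¹ ^ e.skip.length).val) hμ0)
  convert this.of_run hr (show 14 + (45 * d + 2) ≤ 45 * d + 16 by omega) using 2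
  rw [add_comm j, List.append_assoc, List.take_length_add_append, fingerprint_append,
    List.take_append_of_le_length hj]
  push_cast [ZMod.natCast_mod, ZMod.natCast_val, ZMod.cast_id]
  have hcc : c⁻¹ ^ e.skip.length * c ^ e.skip.length = 1 := by
    rw [← mul_pow, inv_mul_cancel₀ hc, one_pow]
  linear_combination (-(cp : ZMod μ) * fingerprint c (x.take j)) * hcc

/-- From a node to its next link: `n` is the number of copies of the block that the prefix contains
and `j'` the length of the rest of the prefix. -/
theorem run_node (hμ : μ * μ < 2 ^ W) (hM : 12 * M.length + 17 < 2 ^ W) {p : ℕ} {nd : IndexNode}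
    (hp : M[p]? = some nd) {j acc cp tmp q y z len : ℕ} (hj : j < 2 ^ W) (hacc : acc < μ)
    (hcp : cp < μ) {n addr j' : ℕ}
    (hn : j / nd.block.length < nd.reps ∧ n = j / nd.block.length ∧ addr = 12 * p + 9 ∧
        j' = j % nd.block.length ∨
      nd.reps ≤ j / nd.block.length ∧ n = nd.reps ∧ addr = 12 * p + 13 ∧
        j' = j - nd.reps * nd.block.length) :
    ∃ k ≤ 15 * Nat.log 2 (2 * n) + 16, ∃ acc' cp' tmp' y' z' len',
      RAMState.run fingerprintProgram W k
          (queryState (encodeIndex c root M) μ 19 j acc cp (12 * p + 5) tmp q y z len) =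
        some (queryState (encodeIndex c root M) μ 5 j' acc' cp' addr tmp' 0 y' z' len') ∧
      acc' < μ ∧ cp' < μ ∧
      (acc' : ZMod μ) = acc + cp * fingerprint c (List.replicate n nd.block).flatten ∧
      (cp' : ZMod μ) = cp * c ^ (List.replicate n nd.block).flatten.length := by
  have hp' : p < M.length := (List.getElem?_eq_some_iff.1 hp).1
  have hμ0 : 0 < μ := (Fact.out : μ.Prime).pos
  have hget := fun i hi => getElem?_encodeIndex c root hp (i := i) hi
  have key : ∃ k ≤ 15, ∃ tmp', RAMState.run fingerprintProgram W k
      (queryState (encodeIndex c root M) μ 19 j acc cp (12 * p + 5) tmp q y z len) =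
        some (queryState (encodeIndex c root M) μ 34 j' acc cp addr tmp' n
          (fingerprint c nd.block).val (c ^ nd.block.length).val nd.block.length) := by
    rcases hn with ⟨h1, rfl, rfl, rfl⟩ | ⟨h1, rfl, rfl, rfl⟩
    · obtain ⟨t, ht⟩ := run_node_left (p := 12 * p + 5) (W := W) (μ := μ) (acc := acc) (cp := cp) (tmp := tmp)
        (q := q) (x := y) (y := z) (len := len) (hget 0 (by omega)) (hget 1 (by omega))
        (hget 2 (by omega)) (hget 3 (by omega)) (by omega) hj h1
      exact ⟨12, by omega, t, ht⟩
    · obtain ⟨t, ht⟩ := run_node_right (p := 12 * p + 5) (W := W) (μ := μ) (acc := acc) (cp := cp) (tmp := tmp)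
        (q := q) (x := y) (y := z) (len := len) (hget 0 (by omega)) (hget 1 (by omega))
        (hget 2 (by omega)) (hget 3 (by omega)) (by omega) hj h1
      exact ⟨15, by omega, t, ht⟩
  obtain ⟨k, hk, tmp', hr⟩ := key
  have hnj : n ≤ j := by
    rcases hn with ⟨_, rfl, _, _⟩ | ⟨h, rfl, _, _⟩
    · exact Nat.div_le_self _ _
    · exact h.trans (Nat.div_le_self _ _)
  obtain ⟨k', hk', acc', cp', t', y', z', hr', ha, hc, hae, hce⟩ := run_loop
    (M := encodeIndex c root M) (j := j') (e := addr) (len := nd.block.length) hμ0 hμ (by omega) n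
    acc cp tmp' (fingerprint c nd.block).val (c ^ nd.block.length).val (by omega) hacc hcp
    (ZMod.val_lt _) (ZMod.val_lt _)
  refine ⟨k + k', by omega, acc', cp', t', y', z', nd.block.length,
    by rw [run_add _ _ _ _ _ _ hr, hr'], ha, hc, ?_, ?_⟩
  · rw [hae, fingerprint_replicate_flatten]
    simp [ZMod.natCast_val]
  · rw [hce]
    simp [ZMod.natCast_val, pow_mul']

theorem Represents.answersAt (hc : c ≠ 0) (hμ : μ * μ < 2 ^ W) (hBW : B < 2 ^ W)
    (hM : 12 * M.length + 17 < 2 ^ W) {p d : ℕ} {x : List ℕ} (h : Represents B M p x d) :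
    AnswersAt c W root M p x d := by
  have hlog2 : Nat.log 2 (2 * 1) = 1 := Nat.log_pow one_lt_two 1
  have hlog0 : Nat.log 2 (2 * 0) = 0 := by simp
  induction h with
  | @letter p nd a hp hblock hreps hB =>
    intro j hj acc cp tmp q y z len hacc hcp
    have hb : nd.block.length = 1 := by simp [hblock]
    obtain rfl | rfl : j = 0 ∨ j = 1 := by simp at hj; omega
    · obtain ⟨k, hk, acc', cp', t', y', z', l', hr, ha, hcp', hae, -⟩ :=
        run_node (c := c) (root := root) (tmp := tmp) (q := q) (y := y) (z := z) (len := len)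
          (n := 0) (addr := 12 * p + 9) (j' := 0) hμ hM hp (j := 0) (by omega) hacc hcp (.inl (by simp [hreps]))
      refine (halts_of_zero_val (T := 2) ha hμ le_rfl ?_).of_run hr (by omega)
      rw [hae]; simp [fingerprint]
    · obtain ⟨k, hk, acc', cp', t', y', z', l', hr, ha, hcp', hae, -⟩ :=
        run_node (c := c) (root := root) (tmp := tmp) (q := q) (y := y) (z := z) (len := len)
          (n := 1) (addr := 12 * p + 13) (j' := 0) hμ hM hp (j := 1) (by omega) hacc hcp (.inr (by simp [hreps, hb]))
      refine (halts_of_zero_val (T := 2) ha hμ le_rfl ?_).of_run hr (by omega)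
      rw [hae]; simp [fingerprint, hblock]
  | @power p nd x post t d hp hblock hx hreps ht hB hleft ih =>
    intro j hj acc cp tmp q y z len hacc hcp
    subst hblock hreps
    have hpos : 0 < nd.block.length := List.length_pos_iff.2 hx
    have hlog : ∀ n ≤ nd.reps, Nat.log 2 (2 * n) ≤ Nat.log 2 nd.reps + 1 := by
      intro n hn
      rw [← Nat.log_mul_base one_lt_two (by omega), mul_comm]
      exact Nat.log_mono_right (by omega)
    have hp' : p < M.length := (List.getElem?_eq_some_iff.1 hp).1
    rcases lt_or_ge (j / nd.block.length) nd.reps with hlt | hge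
    · obtain ⟨k, hk, acc', cp', t', y', z', l', hr, ha, hcp', hae, hce⟩ :=
        run_node (c := c) (root := root) (tmp := tmp) (q := q) (y := y) (z := z) (len := len)
          hμ hM hp (by omega) hacc hcp (.inl ⟨hlt, rfl, rfl, rfl⟩)
      have := ih.halts_follow (j := j % nd.block.length) (tmp := t') (q := 0) (y := y') (z := z')
        (len := l') hc hμ hBW (link_storedAt_left hp) (by omega) hleft.length_le
        (Nat.mod_lt _ hpos).le ha hcp'
      have hl := hlog _ hlt.le
      convert this.of_run hr (T' := 45 * (d + 2 + Nat.log 2 nd.reps) + 2) (by omega) using 2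
      rw [hae, hce, take_replicate_flatten hlt, fingerprint_append]
      ring
    · have hjt : j = nd.reps * nd.block.length := by
        have h1 := (Nat.le_div_iff_mul_le hpos).1 hge
        simp at hj
        omega
      obtain ⟨k, hk, acc', cp', t', y', z', l', hr, ha, hcp', hae, hce⟩ :=
        run_node (c := c) (root := root) (tmp := tmp) (q := q) (y := y) (z := z) (len := len)
          (j' := 0) hμ hM hp (by omega) hacc hcp (.inr ⟨hge, rfl, rfl, by omega⟩)
      have hl := hlog _ le_rfl
      refine (halts_of_zero_val (T := 2) ha hμ le_rfl ?_).of_run hr (by omega)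
      rw [hae, List.take_of_length_le (by simp [hjt])]
  | @append p nd x y post post' d d₁ d₂ hp hblock hx hreps hB hleft hright h₁ h₂ ih₁ ih₂ =>
    intro j hj acc cp tmp q u z len hacc hcp
    subst hblock
    have hpos : 0 < nd.block.length := List.length_pos_iff.2 hx
    have hp' : p < M.length := (List.getElem?_eq_some_iff.1 hp).1
    rcases lt_or_ge j nd.block.length with hlt | hge
    · have hj0 : j / nd.block.length = 0 := Nat.div_eq_of_lt hlt
      obtain ⟨k, hk, acc', cp', t', y', z', l', hr, ha, hcp', hae, hce⟩ :=
        run_node (c := c) (root := root) (tmp := tmp) (q := q) (y := u) (z := z) (len := len)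
          (n := 0) (j := j) (j' := j) hμ hM hp (by omega) hacc hcp
          (.inl ⟨by omega, hj0.symm, rfl, (Nat.mod_eq_of_lt hlt).symm⟩)
      have := ih₁.halts_follow (j := j) (tmp := t') (q := 0) (y := y') (z := z')
        (len := l') hc hμ hBW (link_storedAt_left hp) (by omega) hleft.length_le hlt.le ha hcp'
      convert this.of_run hr (T' := 45 * d + 2) (by omega) using 2
      rw [hae, hce, List.take_append_of_le_length hlt.le]
      simp [fingerprint]
    · obtain ⟨k, hk, acc', cp', t', y', z', l', hr, ha, hcp', hae, hce⟩ :=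
        run_node (c := c) (root := root) (tmp := tmp) (q := q) (y := u) (z := z) (len := len)
          (n := 1) (j := j) (j' := j - nd.block.length) hμ hM hp (by omega) hacc hcp
          (.inr ⟨by rw [hreps]; exact (Nat.le_div_iff_mul_le hpos).2 (by omega), hreps.symm, rfl,
            by rw [hreps, one_mul]⟩)
      have hj' : j - nd.block.length ≤ y.length := by simp at hj; omega
      have := ih₂.halts_follow (j := j - nd.block.length) (tmp := t') (q := 0) (y := y') (z := z')
        (len := l') hc hμ hBW (link_storedAt_right hp) (by omega) hright.length_le hj' ha hcp'
      convert this.of_run hr (T' := 45 * d + 2) (by omega) using 2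
      obtain ⟨i, rfl⟩ : ∃ i, j = nd.block.length + i := ⟨j - nd.block.length, by omega⟩
      rw [hae, hce, List.take_length_add_append, fingerprint_append]
      simp
      ring

/-- A represented string is queried through any link to one of its occurrences. -/
theorem ramAnswers_of_represents (hc : c ≠ 0) (hμ : μ * μ < 2 ^ W) (hBW : B < 2 ^ W)
    (hM : 12 * M.length + 17 < 2 ^ W) {d : ℕ} {x post : List ℕ}
    (h : Represents B M root.node (root.skip ++ x ++ post) d) {j : ℕ} (hj : j ≤ x.length) :
    RAMAnswers fingerprintProgram W (encodeIndex c root M) j (45 * d + 21)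
      (fingerprint c (x.take j)).val := by
  have h1 : 1 < μ := (Fact.out : μ.Prime).one_lt
  have := (h.answersAt (root := root) hc hμ hBW hM).halts_follow (j := j) (acc := 0) (cp := 1)
    (tmp := 0) (q := 0) (y := 0) (z := 0) (len := 0) hc hμ hBW link_storedAt_root (by omega)
    h.length_le hj (by omega) h1
  have h2 := this.of_run (run_start (j := j) (μ := μ) rfl (by omega))
    (show 5 + (45 * d + 16) ≤ 45 * d + 21 by omega)
  rw [Nat.cast_zero, zero_add, Nat.cast_one, one_mul] at h2
  exact h2

end correctness

/-! ### Building stores -/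

/-- The numbers in a link are small: lengths are at most `B`, and node numbers at most `n`. -/
def Link.Bounded (B n : ℕ) (e : Link) : Prop := e.skip.length ≤ B ∧ e.node ≤ n

/-- The numbers in a node are small: lengths and repetition counts are at most `B`, and node
numbers at most `n`. -/
def IndexNode.Bounded (B n : ℕ) (nd : IndexNode) : Prop :=
  nd.block.length ≤ B ∧ nd.reps ≤ B ∧ nd.left.Bounded B n ∧ nd.right.Bounded B n

/-- All nodes of a store are bounded, node numbers by the size of the store. -/
def StoreBounded (B : ℕ) (M : List IndexNode) : Prop := ∀ nd ∈ M, nd.Bounded B M.length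

theorem StoreBounded.append_node {B : ℕ} {M : List IndexNode} (hM : StoreBounded B M)
    {nd : IndexNode} (hnd : nd.Bounded B M.length) : StoreBounded B (M ++ [nd]) := by
  have key : ∀ m : IndexNode, m.Bounded B M.length → m.Bounded B (M ++ [nd]).length := by
    rintro m ⟨h1, h2, ⟨h3, h4⟩, h5, h6⟩
    simp only [IndexNode.Bounded, Link.Bounded, List.length_append, List.length_singleton]
    omega
  intro m hm
  rcases List.mem_append.1 hm with h | h
  · exact key m (hM m h)
  · rw [List.mem_singleton.1 h]
    exact key nd hnd

theorem StoreBounded.encode_lt {μ : ℕ} [NeZero μ] {c : ZMod μ} {B W : ℕ} {M : List IndexNode}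
    {root : Link} (hM : StoreBounded B M) (hroot : root.Bounded B M.length) (hμ : μ < 2 ^ W)
    (hB : B < 2 ^ W) (hW : 12 * M.length + 5 < 2 ^ W) :
    ∀ v ∈ encodeIndex c root M, v < 2 ^ W := by
  have hval : ∀ z : ZMod μ, z.val < 2 ^ W := fun z => (ZMod.val_lt z).trans hμ
  have hlink : ∀ e : Link, e.Bounded B M.length → ∀ v ∈ e.encode c, v < 2 ^ W := by
    rintro e ⟨h1, h2⟩ v hv
    simp only [Link.encode, List.mem_cons, List.not_mem_nil, or_false] at hv
    rcases hv with rfl | rfl | rfl | rfl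
    · omega
    · exact hval _
    · exact hval _
    · omega
  intro v hv
  simp only [encodeIndex, List.mem_cons, List.mem_append, List.mem_flatMap] at hv
  rcases hv with rfl | hv | ⟨nd, hnd, hv⟩
  · exact hμ
  · exact hlink root hroot v hv
  · obtain ⟨h1, h2, h3, h4⟩ := hM nd hnd
    simp only [IndexNode.encode, List.mem_cons, List.mem_append, List.not_mem_nil, or_false] at hv
    rcases hv with (rfl | rfl | rfl | rfl) | hv | hv
    · omega
    · exact hval _
    · exact hval _
    · omega
    · exact hlink _ h3 v hv
    · exact hlink _ h4 v hv

/-- Some link into the store `M` refers to the string `x`, and queries through it cost at most `d`. -/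
def Accessible (B : ℕ) (M : List IndexNode) (x : List ℕ) (d : ℕ) : Prop :=
  ∃ (e : Link) (post : List ℕ) (d' : ℕ), d' ≤ d ∧
    Represents B M e.node (e.skip ++ x ++ post) d'

section
variable {B d d₁ d₂ : ℕ} {M : List IndexNode} {x y : List ℕ}

theorem Accessible.append_store (N : List IndexNode) (h : Accessible B M x d) :
    Accessible B (M ++ N) x d := by
  obtain ⟨e, post, d', hd, h⟩ := h
  exact ⟨e, post, d', hd, h.mono N⟩

theorem Accessible.mono (h : Accessible B M x d₁) (hd : d₁ ≤ d₂) : Accessible B M x d₂ := by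
  obtain ⟨e, post, d', hd', h⟩ := h
  exact ⟨e, post, d', hd'.trans hd, h⟩

/-- Since links may skip a prefix, infixes of accessible strings are accessible at no extra cost. -/
theorem Accessible.of_infix (h : Accessible B M y d) (hxy : x <:+: y) : Accessible B M x d := by
  obtain ⟨e, post, d', hd, h⟩ := h
  obtain ⟨u, v, rfl⟩ := hxy
  exact ⟨⟨e.node, e.skip ++ u⟩, v ++ post, d', hd, by simpa using h⟩

theorem Represents.accessible {p : ℕ} (h : Represents B M p x d) : Accessible B M x d :=
  ⟨⟨p, []⟩, [], d, le_rfl, by simpa using h⟩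

theorem link_bounded {e : Link} {post : List ℕ}
    (h : Represents B M e.node (e.skip ++ x ++ post) d) : e.Bounded B M.length := by
  have := h.length_le
  simp only [List.length_append] at this
  exact ⟨by omega, h.lt_length.le⟩

theorem getElem?_append_singleton_length {α : Type*} (M : List α) (nd : α) :
    (M ++ [nd])[M.length]? = some nd := by simp

theorem exists_accessible_letter (hM : StoreBounded B M) (hB : 1 ≤ B) (a : ℕ) :
    ∃ nd, StoreBounded B (M ++ [nd]) ∧ Accessible B (M ++ [nd]) [a] 1 := by
  refine ⟨⟨[a], 1, ⟨0, []⟩, ⟨0, []⟩⟩, hM.append_node ?_, (Represents.letter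
    (getElem?_append_singleton_length _ _) rfl rfl hB).accessible⟩
  simp [IndexNode.Bounded, Link.Bounded, hB]

theorem exists_accessible_power (hM : StoreBounded B M) {t : ℕ} (ht : 1 ≤ t) (hx : x ≠ [])
    (hB : (List.replicate t x).flatten.length ≤ B) (h : Accessible B M x d) :
    ∃ nd, StoreBounded B (M ++ [nd]) ∧
      Accessible B (M ++ [nd]) (List.replicate t x).flatten (d + 2 + Nat.log 2 t) := by
  obtain ⟨e, post, d', hd, h⟩ := h
  have hpos : 0 < x.length := List.length_pos_iff.2 hx
  have hB' : t * x.length ≤ B := by simpa using hB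
  refine ⟨⟨x, t, e, ⟨0, []⟩⟩, hM.append_node ⟨?_, ?_, link_bounded h, ?_⟩,
    (Represents.power (t := t) (getElem?_append_singleton_length _ _) rfl hx rfl ht hB
      (h.mono _)).accessible.mono (by omega)⟩
  · exact (Nat.le_mul_of_pos_left _ ht).trans hB'
  · exact (Nat.le_mul_of_pos_right _ hpos).trans hB'
  · simp [Link.Bounded]

theorem exists_accessible_append (hM : StoreBounded B M) (hx : x ≠ [])
    (hB : (x ++ y).length ≤ B) (h₁ : Accessible B M x d) (h₂ : Accessible B M y d) :
    ∃ nd, StoreBounded B (M ++ [nd]) ∧ Accessible B (M ++ [nd]) (x ++ y) (d + 1) := by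
  obtain ⟨e₁, post₁, d₁, hd₁, h₁⟩ := h₁
  obtain ⟨e₂, post₂, d₂, hd₂, h₂⟩ := h₂
  have hpos : 0 < x.length := List.length_pos_iff.2 hx
  have hB' : x.length + y.length ≤ B := by simpa using hB
  refine ⟨⟨x, 1, e₁, e₂⟩, hM.append_node ⟨?_, ?_, link_bounded h₁, link_bounded h₂⟩,
    (Represents.append (getElem?_append_singleton_length _ _) rfl hx rfl hB
      (h₁.mono _) (h₂.mono _) (by omega) (by omega)).accessible⟩ <;> simp only <;> omega

end

/-- The member of a list of strings in which position `k` of the concatenation lies. -/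
theorem exists_split {α : Type*} (xs : List (List α)) (k : ℕ) (hk : k < xs.flatten.length) :
    ∃ u x v, xs = u ++ x :: v ∧ u.flatten.length ≤ k ∧ k < u.flatten.length + x.length := by
  induction xs generalizing k with
  | nil => simp at hk
  | cons y ys ih =>
    rcases lt_or_ge k y.length with h | h
    · exact ⟨[], y, ys, rfl, by simp, by simpa⟩
    · have hk' : k < y.length + ys.flatten.length := by simpa using hk
      obtain ⟨u, x, v, rfl, h1, h2⟩ := ih (k - y.length) (by omega)
      refine ⟨y :: u, x, v, rfl, ?_, ?_⟩ <;> simp only [List.flatten_cons, List.length_append] <;>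
        omega

theorem log_add_one_le {a b : ℕ} (ha : 0 < a) (h : 2 * a ≤ b) :
    Nat.log 2 a + 1 ≤ Nat.log 2 b := by
  rw [← Nat.log_mul_base one_lt_two ha.ne', mul_comm]
  exact Nat.log_mono_right h

theorem flatten_ne_nil {α : Type*} {xs : List (List α)} (hne : xs ≠ [])
    (h : ∀ x ∈ xs, x ≠ []) : xs.flatten ≠ [] := by
  obtain ⟨x, ys, rfl⟩ := List.exists_cons_of_ne_nil hne
  simp [h x (by simp)]

/-- A biased search tree. If the strings `x` in `xs` are accessible at cost `a + 2 * log |x|`, then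
fewer than `|xs|` new nodes make their concatenation accessible with a bound of the same form. The
tree is built by splitting `xs` into two parts of at most half the total length each and the string
between them; a step into a half adds at most two units of cost and lowers the logarithm by one. -/
theorem exists_accessible_flatten {B a : ℕ} (n : ℕ) : ∀ (xs : List (List ℕ)) (M : List IndexNode),
    xs.length = n → xs ≠ [] → StoreBounded B M →
    (∀ x ∈ xs, x ≠ [] ∧ Accessible B M x (a + 2 * Nat.log 2 x.length)) →
    xs.flatten.length ≤ B →
    ∃ N : List IndexNode, N.length + 1 ≤ xs.length ∧ StoreBounded B (M ++ N) ∧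
      Accessible B (M ++ N) xs.flatten (a + 2 + 2 * Nat.log 2 xs.flatten.length) := by
  induction n using Nat.strong_induction_on with
  | _ n ih =>
    intro xs M hn hne hM hxs hB
    have hpos : 0 < xs.flatten.length :=
      List.length_pos_iff.2 (flatten_ne_nil hne fun x hx => (hxs x hx).1)
    obtain ⟨u, x, v, rfl, h1, h2⟩ := exists_split xs (xs.flatten.length / 2) (by omega)
    have hS : (u ++ x :: v).flatten.length = u.flatten.length + (x.length + v.flatten.length) := by
      simp
    have hlen : (u ++ x :: v).length = u.length + (v.length + 1) := by simp
    set S := (u ++ x :: v).flatten.length with hSdef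
    have half : ∀ (w : List (List ℕ)) (M' : List IndexNode), w ≠ [] →
        (∀ y ∈ w, y ∈ u ++ x :: v) → w.length < n → 2 * w.flatten.length ≤ S →
        StoreBounded B (M ++ M') →
        ∃ N : List IndexNode, N.length + 1 ≤ w.length ∧ StoreBounded B (M ++ M' ++ N) ∧
          Accessible B (M ++ M' ++ N) w.flatten (a + 2 * Nat.log 2 S) := by
      intro w M' hw hsub hlt h2w hM'
      have hwpos : 0 < w.flatten.length :=
        List.length_pos_iff.2 (flatten_ne_nil hw fun y hy => (hxs y (hsub y hy)).1)
      obtain ⟨N, hN, hb, hacc⟩ := ih w.length hlt w (M ++ M') rfl hw hM'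
        (fun y hy => ⟨(hxs y (hsub y hy)).1, (hxs y (hsub y hy)).2.append_store M'⟩) (by omega)
      have := log_add_one_le hwpos h2w
      exact ⟨N, hN, hb, hacc.mono (by omega)⟩
    obtain ⟨hx, hxacc⟩ := hxs x (by simp)
    have hxS : Nat.log 2 x.length ≤ Nat.log 2 S := Nat.log_mono_right (by omega)
    have right : ∃ N : List IndexNode, N.length ≤ v.length ∧ StoreBounded B (M ++ N) ∧
        Accessible B (M ++ N) (x ++ v.flatten) (a + 2 * Nat.log 2 S + 1) := by
      rcases eq_or_ne v [] with rfl | hv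
      · exact ⟨[], by simp, by simpa using hM, by simpa using hxacc.mono (by omega)⟩
      · obtain ⟨N, hN, hb, hacc⟩ := half v [] hv (fun y hy => by simp [hy]) (by omega) (by omega)
          (by simpa using hM)
        rw [List.append_nil] at hb hacc
        obtain ⟨nd, hb', hacc'⟩ := exists_accessible_append hb hx
          (by rw [List.length_append]; omega)
          ((hxacc.append_store N).mono (show _ ≤ a + 2 * Nat.log 2 S by omega)) hacc
        exact ⟨N ++ [nd], by simpa using hN, by rwa [← List.append_assoc],
          by rwa [← List.append_assoc]⟩
    obtain ⟨N, hN, hb, hacc⟩ := right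
    rcases eq_or_ne u [] with rfl | hu
    · exact ⟨N, by simp; omega, hb, by simpa using hacc.mono (by omega)⟩
    · obtain ⟨N', hN', hb', hacc'⟩ := half u N hu (fun y hy => by simp [hy]) (by omega) (by omega) hb
      obtain ⟨nd, hb'', hacc''⟩ := exists_accessible_append hb'
        (flatten_ne_nil hu fun y hy => (hxs y (by simp [hy])).1)
        (show (u.flatten ++ (x ++ v.flatten)).length ≤ B by
          simp only [List.length_append]; omega)
        (hacc'.mono (show _ ≤ a + 2 * Nat.log 2 S + 1 by omega)) (hacc.append_store N')
      refine ⟨N ++ N' ++ [nd], by simp; omega, by simpa using hb'', ?_⟩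
      have : Accessible B (M ++ (N ++ N' ++ [nd])) (u ++ x :: v).flatten
          (a + 2 * Nat.log 2 S + 1 + 1) := by simpa using hacc''
      exact this.mono (by omega)

/-! ### The symmetric centroid decomposition -/

namespace RLSLP

section
variable {α : Type*} (G : RLSLP α)

/-- The string derived from a variable. -/
def str (i : Fin (G.top + 1)) : List α := G.expand i.1 i.2

/-- The variables on the right-hand side of a rule, in order and with multiplicity; a run-length
rule `A → B ^ t` has `t` kids `B`. -/
def kids (i : Fin (G.top + 1)) : List (Fin (G.top + 1)) :=
  match G.rule i with
  | .terminal _ => []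
  | .seq Bs _ => Bs.map (Fin.castLE i.2.le)
  | .power B t _ => List.replicate t (Fin.castLE i.2.le B)

variable {G}

theorem str_of_terminal {i : Fin (G.top + 1)} {a : α} (h : G.rule i = .terminal a) :
    G.str i = [a] := by
  rw [str, expand, h]

theorem kids_of_terminal {i : Fin (G.top + 1)} {a : α} (h : G.rule i = .terminal a) :
    G.kids i = [] := by
  rw [kids, h]

theorem kids_of_seq {i : Fin (G.top + 1)} {Bs : List (Fin i)} {hk : 1 < Bs.length}
    (h : G.rule i = .seq Bs hk) : G.kids i = Bs.map (Fin.castLE i.2.le) := by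
  rw [kids, h]

theorem kids_of_power {i : Fin (G.top + 1)} {B : Fin i} {t : ℕ} {ht : 2 < t}
    (h : G.rule i = .power B t ht) : G.kids i = List.replicate t (Fin.castLE i.2.le B) := by
  rw [kids, h]

theorem str_of_seq {i : Fin (G.top + 1)} {Bs : List (Fin i)} {hk : 1 < Bs.length}
    (h : G.rule i = .seq Bs hk) : G.str i = ((G.kids i).map G.str).flatten := by
  rw [kids_of_seq h, str, expand, h]
  simp only [List.flatMap_def, List.map_map]
  rfl

theorem str_of_power {i : Fin (G.top + 1)} {B : Fin i} {t : ℕ} {ht : 2 < t}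
    (h : G.rule i = .power B t ht) : G.str i = ((G.kids i).map G.str).flatten := by
  rw [kids_of_power h, str, expand, h, List.map_replicate]
  rfl

theorem lt_of_mem_kids {i k : Fin (G.top + 1)} (h : k ∈ G.kids i) : k < i := by
  cases hr : G.rule i with
  | terminal a => simp [kids_of_terminal hr] at h
  | seq Bs hk =>
    rw [kids_of_seq hr] at h
    obtain ⟨B, -, rfl⟩ := List.mem_map.1 h
    exact B.2
  | power B t ht =>
    rw [kids_of_power hr] at h
    rw [List.eq_of_mem_replicate h]
    exact B.2

theorem str_of_mem_kids {i k : Fin (G.top + 1)} (h : k ∈ G.kids i) :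
    G.str i = ((G.kids i).map G.str).flatten := by
  cases hr : G.rule i with
  | terminal a => simp [kids_of_terminal hr] at h
  | seq Bs hk => exact str_of_seq hr
  | power B t ht => exact str_of_power hr

theorem str_ne_nil (i : Fin (G.top + 1)) : G.str i ≠ [] := by
  induction i using WellFoundedLT.induction with
  | _ i ih =>
    have key : ∀ k ∈ G.kids i, G.str i ≠ [] := by
      intro k hk
      rw [str_of_mem_kids hk]
      refine flatten_ne_nil (by simpa using List.ne_nil_of_mem hk) ?_
      intro x hx
      obtain ⟨l, hl, rfl⟩ := List.mem_map.1 hx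
      exact ih l (lt_of_mem_kids hl)
    cases hr : G.rule i with
    | terminal a => simp [str_of_terminal hr]
    | seq Bs hk =>
      obtain ⟨B, hB⟩ := List.exists_mem_of_ne_nil Bs (by rintro rfl; simp at hk)
      exact key _ (by rw [kids_of_seq hr]; exact List.mem_map_of_mem hB)
    | power B t ht =>
      exact key (Fin.castLE i.2.le B) (by rw [kids_of_power hr]; simp; omega)

variable (G) in
/-- The length of the string derived from a variable. -/
def len (i : Fin (G.top + 1)) : ℕ := (G.str i).length

theorem len_pos (i : Fin (G.top + 1)) : 0 < G.len i := List.length_pos_iff.2 (str_ne_nil i)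

theorem len_of_mem_kids {i k : Fin (G.top + 1)} (h : k ∈ G.kids i) :
    G.len i = ((G.kids i).map G.len).sum := by
  rw [len, str_of_mem_kids h, List.length_flatten, List.map_map]
  rfl

theorem sum_len_kids_le (i : Fin (G.top + 1)) : ((G.kids i).map G.len).sum ≤ G.len i := by
  rcases List.eq_nil_or_concat (G.kids i) with h | ⟨l, k, h⟩
  · simp [h]
  · exact (len_of_mem_kids (k := k) (by simp [h])).ge

theorem len_le_of_mem_kids {i k : Fin (G.top + 1)} (h : k ∈ G.kids i) : G.len k ≤ G.len i :=
  (List.single_le_sum (by simp) _ (List.mem_map_of_mem h)).trans (sum_len_kids_le i)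

variable (G) in
/-- The number of occurrences of the variable `v` in the derivation tree of `u`. -/
def occ (v u : Fin (G.top + 1)) : ℕ :=
  if u = v then 1 else ((G.kids u).attach.map fun k => occ v k.1).sum
termination_by u
decreasing_by exact lt_of_mem_kids k.2

theorem occ_self (v : Fin (G.top + 1)) : G.occ v v = 1 := by rw [occ, if_pos rfl]

theorem occ_of_ne {v u : Fin (G.top + 1)} (h : u ≠ v) :
    G.occ v u = ((G.kids u).map (G.occ v)).sum := by
  rw [occ, if_neg h]
  conv_rhs => rw [← List.attach_map_subtype_val (G.kids u), List.map_map]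
  rfl

theorem occ_eq_zero_of_lt {v u : Fin (G.top + 1)} (h : u < v) : G.occ v u = 0 := by
  induction u using WellFoundedLT.induction with
  | _ u ih =>
    rw [occ_of_ne h.ne, List.sum_eq_zero]
    intro x hx
    obtain ⟨k, hk, rfl⟩ := List.mem_map.1 hx
    exact ih k (lt_of_mem_kids hk) ((lt_of_mem_kids hk).trans h)

/-- The occurrences of `v` in the derivation tree of `u` derive disjoint parts of the string. -/
theorem occ_mul_len_le (v u : Fin (G.top + 1)) : G.occ v u * G.len v ≤ G.len u := by
  induction u using WellFoundedLT.induction with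
  | _ u ih =>
    rcases eq_or_ne u v with rfl | h
    · rw [occ_self, one_mul]
    · rw [occ_of_ne h, ← List.sum_map_mul_right]
      exact (List.sum_le_sum fun k hk => ih k (lt_of_mem_kids hk)).trans (sum_len_kids_le u)

theorem occ_le_of_mem_kids {u v : Fin (G.top + 1)} (h : v ∈ G.kids u) (z : Fin (G.top + 1)) :
    G.occ u z ≤ G.occ v z := by
  induction z using WellFoundedLT.induction with
  | _ z ih =>
    have hvu := lt_of_mem_kids h
    rcases eq_or_ne z v with rfl | hzv
    · rw [occ_eq_zero_of_lt hvu]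
      exact Nat.zero_le _
    rw [occ_of_ne hzv]
    rcases eq_or_ne z u with rfl | hzu
    · rw [occ_self]
      exact (occ_self v).ge.trans <| List.single_le_sum (by simp) _ (List.mem_map_of_mem h)
    · rw [occ_of_ne hzu]
      exact List.sum_le_sum fun k hk => ih k (lt_of_mem_kids hk)

/-- The case of `occ_add_le` in which the tree is that of one of the two parents. -/
theorem occ_add_le_aux {u₁ u₂ v : Fin (G.top + 1)} (h₁ : v ∈ G.kids u₁) (h₂ : v ∈ G.kids u₂)
    (hne : u₁ ≠ u₂) : G.occ u₁ u₁ + G.occ u₂ u₁ ≤ G.occ v u₁ := by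
  rw [occ_self, occ_of_ne hne, occ_of_ne (lt_of_mem_kids h₁).ne', add_comm]
  refine Nat.succ_le_of_lt (List.sum_lt_sum _ _ (fun k _ => occ_le_of_mem_kids h₂ k) ⟨v, h₁, ?_⟩)
  rw [occ_eq_zero_of_lt (lt_of_mem_kids h₂), occ_self]
  exact one_pos

/-- Every occurrence of a parent of `v` contributes its own occurrence of `v`. -/
theorem occ_add_le {u₁ u₂ v : Fin (G.top + 1)} (h₁ : v ∈ G.kids u₁) (h₂ : v ∈ G.kids u₂)
    (hne : u₁ ≠ u₂) (z : Fin (G.top + 1)) : G.occ u₁ z + G.occ u₂ z ≤ G.occ v z := by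
  induction z using WellFoundedLT.induction with
  | _ z ih =>
    rcases eq_or_ne z u₁ with rfl | hz₁
    · exact occ_add_le_aux h₁ h₂ hne
    rcases eq_or_ne z u₂ with rfl | hz₂
    · rw [add_comm]
      exact occ_add_le_aux h₂ h₁ hne.symm
    rcases eq_or_ne z v with rfl | hzv
    · rw [occ_eq_zero_of_lt (lt_of_mem_kids h₁), occ_eq_zero_of_lt (lt_of_mem_kids h₂)]
      exact Nat.zero_le _
    rw [occ_of_ne hz₁, occ_of_ne hz₂, occ_of_ne hzv, ← List.sum_map_add]
    exact List.sum_le_sum fun k hk => ih k (lt_of_mem_kids hk)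

variable (G) in
/-- The start variable. -/
def root : Fin (G.top + 1) := ⟨G.top, Nat.lt_succ_self _⟩

variable (G) in
/-- The variable occurs in the derivation tree of the start variable. -/
def Reachable (v : Fin (G.top + 1)) : Prop := 0 < G.occ v G.root

variable (G) in
/-- The rank decreases weakly from a variable to its kids. It adds up the two logarithms by which
the symmetric centroid decomposition classifies variables (that of the length, and that of the
number of occurrences, reversed), so it is constant along an edge only if both are. -/
def rank (v : Fin (G.top + 1)) : ℕ :=
  Nat.log 2 (G.len v) + (Nat.log 2 (G.len G.root) - Nat.log 2 (G.occ v G.root))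

theorem Reachable.of_mem_kids {u v : Fin (G.top + 1)} (hu : G.Reachable u) (h : v ∈ G.kids u) :
    G.Reachable v :=
  lt_of_lt_of_le hu (occ_le_of_mem_kids h _)

theorem log_occ_le (v : Fin (G.top + 1)) :
    Nat.log 2 (G.occ v G.root) ≤ Nat.log 2 (G.len G.root) :=
  Nat.log_mono_right ((Nat.le_mul_of_pos_right _ (len_pos v)).trans (occ_mul_len_le v _))

theorem Reachable.len_le {v : Fin (G.top + 1)} (h : G.Reachable v) : G.len v ≤ G.len G.root :=
  (Nat.le_mul_of_pos_left _ h).trans (occ_mul_len_le v _)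

theorem rank_le_of_mem_kids {u v : Fin (G.top + 1)} (h : v ∈ G.kids u) : G.rank v ≤ G.rank u := by
  have h1 := Nat.log_mono_right (b := 2) (len_le_of_mem_kids h)
  have h2 := Nat.log_mono_right (b := 2) (occ_le_of_mem_kids h G.root)
  unfold rank
  omega

theorem log_eq_of_rank_eq {u v : Fin (G.top + 1)} (h : v ∈ G.kids u) (hr : G.rank v = G.rank u) :
    Nat.log 2 (G.len v) = Nat.log 2 (G.len u) ∧
      Nat.log 2 (G.occ v G.root) = Nat.log 2 (G.occ u G.root) := by
  have h1 := Nat.log_mono_right (b := 2) (len_le_of_mem_kids h)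
  have h2 := Nat.log_mono_right (b := 2) (occ_le_of_mem_kids h G.root)
  have h3 := log_occ_le u
  have h4 := log_occ_le v
  unfold rank at hr
  omega

theorem log_lt_of_add_le {a b s : ℕ} (ha : 0 < a) (hb : 0 < b) (h : a + b ≤ s)
    (hab : Nat.log 2 a = Nat.log 2 b) : Nat.log 2 b < Nat.log 2 s := by
  rcases le_total a b with hle | hle
  · rw [← hab]
    exact log_add_one_le ha (by omega)
  · exact log_add_one_le hb (by omega)

variable (G) in
/-- An edge of the grammar along which the rank stays the same. -/
def CentroidEdge (u v : Fin (G.top + 1)) : Prop :=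
  G.Reachable u ∧ v ∈ G.kids u ∧ G.rank v = G.rank u

/-- A variable has at most one kid of the same rank, counted with multiplicity: two kids
of at least `2 ^ e` letters each make the length of the parent at least `2 ^ (e + 1)`. -/
theorem CentroidEdge.exists_split {u v : Fin (G.top + 1)} (h : G.CentroidEdge u v) :
    ∃ l r, G.kids u = l ++ v :: r ∧ ∀ x, x ∈ l ∨ x ∈ r → G.rank x < G.rank u := by
  obtain ⟨-, hv, hr⟩ := h
  obtain ⟨l, r, hlr⟩ := List.append_of_mem hv
  refine ⟨l, r, hlr, fun x hx => ?_⟩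
  have hxu : x ∈ G.kids u := by
    rw [hlr]
    rcases hx with hx | hx <;> simp [hx]
  refine lt_of_le_of_ne (rank_le_of_mem_kids hxu) fun hxr => ?_
  have h1 := (log_eq_of_rank_eq hxu hxr).1
  have h2 := (log_eq_of_rank_eq hv hr).1
  have h3 : G.len x + G.len v ≤ G.len u := by
    refine le_trans ?_ (sum_len_kids_le u)
    rw [hlr]
    simp only [List.map_append, List.map_cons, List.sum_append, List.sum_cons]
    rcases hx with hx | hx
    · have := List.single_le_sum (l := l.map G.len) (by simp) _ (List.mem_map_of_mem hx)
      omega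
    · have := List.single_le_sum (l := r.map G.len) (by simp) _ (List.mem_map_of_mem hx)
      omega
  have := log_lt_of_add_le (len_pos x) (len_pos v) h3 (h1.trans h2.symm)
  omega

theorem CentroidEdge.right_unique {u v w : Fin (G.top + 1)} (h : G.CentroidEdge u v)
    (h' : G.CentroidEdge u w) : w = v := by
  obtain ⟨l, r, hlr, hlt⟩ := h.exists_split
  have hw := h'.2.1
  rw [hlr, List.mem_append, List.mem_cons] at hw
  rcases hw with hw | hw | hw
  · exact absurd h'.2.2 (hlt w (.inl hw)).ne
  · exact hw
  · exact absurd h'.2.2 (hlt w (.inr hw)).ne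

/-- A variable has at most one parent of the same rank: two parents with at least `2 ^ e` occurrences
each give it at least `2 ^ (e + 1)` occurrences. -/
theorem CentroidEdge.left_unique {u₁ u₂ v : Fin (G.top + 1)} (h₁ : G.CentroidEdge u₁ v)
    (h₂ : G.CentroidEdge u₂ v) : u₁ = u₂ := by
  by_contra hne
  have h3 := (log_eq_of_rank_eq h₁.2.1 h₁.2.2).2
  have h4 := (log_eq_of_rank_eq h₂.2.1 h₂.2.2).2
  have := log_lt_of_add_le h₁.1 h₂.1 (occ_add_le h₁.2.1 h₂.2.1 hne _) (h3.symm.trans h4)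
  omega

open Classical in
variable (G) in
/-- The variables on the path of centroid edges that starts in `v`. -/
noncomputable def centroidPath (v : Fin (G.top + 1)) : Finset (Fin (G.top + 1)) :=
  Finset.univ.filter (Relation.ReflTransGen G.CentroidEdge v)

theorem mem_centroidPath {u v : Fin (G.top + 1)} :
    u ∈ G.centroidPath v ↔ Relation.ReflTransGen G.CentroidEdge v u := by
  simp [centroidPath]

theorem self_mem_centroidPath (v : Fin (G.top + 1)) : v ∈ G.centroidPath v :=
  mem_centroidPath.2 .refl

theorem path_spec {u v : Fin (G.top + 1)} (h : Relation.ReflTransGen G.CentroidEdge v u)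
    (hv : G.Reachable v) : G.Reachable u ∧ G.rank u = G.rank v ∧
      Nat.log 2 (G.len u) = Nat.log 2 (G.len v) ∧ u ≤ v := by
  induction h with
  | refl => exact ⟨hv, rfl, rfl, le_rfl⟩
  | tail _ he ih =>
    obtain ⟨h1, h2, h3, h4⟩ := ih
    exact ⟨h1.of_mem_kids he.2.1, he.2.2.trans h2, (log_eq_of_rank_eq he.2.1 he.2.2).1.trans h3,
      (lt_of_mem_kids he.2.1).le.trans h4⟩

theorem centroidPath_of_edge {u v : Fin (G.top + 1)} (h : G.CentroidEdge u v) :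
    G.centroidPath u = insert u (G.centroidPath v) ∧ u ∉ G.centroidPath v := by
  constructor
  · ext x
    rw [Finset.mem_insert, mem_centroidPath, mem_centroidPath]
    constructor
    · intro hx
      rcases hx.cases_head with rfl | ⟨w, hw, hx⟩
      · exact .inl rfl
      · exact .inr (h.right_unique hw ▸ hx)
    · rintro (rfl | hx)
      · exact .refl
      · exact .head h hx
  · intro hu
    have := (path_spec (mem_centroidPath.1 hu) (h.1.of_mem_kids h.2.1)).2.2.2
    exact absurd (lt_of_mem_kids h.2.1) (not_lt.2 this)

theorem centroidPath_of_no_edge {u : Fin (G.top + 1)} (h : ∀ v, ¬ G.CentroidEdge u v) :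
    G.centroidPath u = {u} := by
  ext x
  rw [Finset.mem_singleton, mem_centroidPath]
  constructor
  · intro hx
    rcases hx.cases_head with rfl | ⟨w, hw, -⟩
    · rfl
    · exact absurd hw (h w)
  · rintro rfl
    exact .refl

open Classical in
variable (G) in
/-- The reachable variables in which a maximal path of centroid edges starts. -/
noncomputable def heads : Finset (Fin (G.top + 1)) :=
  Finset.univ.filter fun h => G.Reachable h ∧ ∀ u, ¬ G.CentroidEdge u h

theorem mem_heads {h : Fin (G.top + 1)} :
    h ∈ G.heads ↔ G.Reachable h ∧ ∀ u, ¬ G.CentroidEdge u h := by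
  simp [heads]

theorem exists_head {v : Fin (G.top + 1)} (hv : G.Reachable v) :
    ∃ h ∈ G.heads, v ∈ G.centroidPath h := by
  induction v using WellFoundedGT.induction with
  | _ v ih =>
    by_cases h : ∃ u, G.CentroidEdge u v
    · obtain ⟨u, hu⟩ := h
      obtain ⟨h, hh, hp⟩ := ih u (lt_of_mem_kids hu.2.1) hu.1
      exact ⟨h, hh, mem_centroidPath.2 ((mem_centroidPath.1 hp).tail hu)⟩
    · push Not at h
      exact ⟨v, mem_heads.2 ⟨hv, h⟩, self_mem_centroidPath v⟩

theorem heads_eq_of_reaches {g h : Fin (G.top + 1)} (hh : h ∈ G.heads)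
    (hp : Relation.ReflTransGen G.CentroidEdge g h) : g = h := by
  rcases hp.cases_tail with h1 | ⟨w, -, hw⟩
  · exact h1.symm
  · exact absurd hw ((mem_heads.1 hh).2 w)

theorem heads_pairwiseDisjoint :
    (G.heads : Set (Fin (G.top + 1))).PairwiseDisjoint G.centroidPath := by
  intro g hg h hh hne
  refine Finset.disjoint_left.2 fun v hv hv' => hne ?_
  have h1 := Relation.reflTransGen_swap.2 (mem_centroidPath.1 hv)
  have h2 := Relation.reflTransGen_swap.2 (mem_centroidPath.1 hv')
  have hu : Relator.RightUnique (Function.swap G.CentroidEdge) := fun _ _ _ a b => a.left_unique b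
  rcases Relation.ReflTransGen.total_of_right_unique hu h1 h2 with h3 | h3
  · exact (heads_eq_of_reaches hg (Relation.reflTransGen_swap.1 h3)).symm
  · exact heads_eq_of_reaches hh (Relation.reflTransGen_swap.1 h3)

end
end RLSLP

/-! ### The index of a grammar -/

namespace RLSLP

section
variable {G : RLSLP ℕ} {B : ℕ}

variable (G B) in
/-- The string of `v` is accessible at the cost that the construction guarantees: four units for
each rank level and two for each doubling of the length. -/
def Stored (M : List IndexNode) (v : Fin (G.top + 1)) : Prop :=
  Accessible B M (G.str v) (4 * (G.rank v + 1) + 2 * Nat.log 2 (G.len v))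

variable (G B) in
/-- `x` is the concatenation of the nonempty list `xs` of nonempty strings, which are accessible
at the cost that `exists_accessible_flatten` asks for. -/
def Decomposes (M : List IndexNode) (a : ℕ) (x : List ℕ) (xs : List (List ℕ)) : Prop :=
  xs.flatten = x ∧ xs ≠ [] ∧
    ∀ y ∈ xs, y ≠ [] ∧ Accessible B M y (a + 2 * Nat.log 2 y.length)

theorem Stored.item {M : List IndexNode} {x v : Fin (G.top + 1)} (h : G.Stored B M x)
    (hr : G.rank x < G.rank v) :
    G.str x ≠ [] ∧
      Accessible B M (G.str x) (4 * G.rank v + 2 + 2 * Nat.log 2 (G.str x).length) := by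
  refine ⟨str_ne_nil x, h.mono ?_⟩
  rw [len]
  omega

/-- The string of the first variable `v` of a path is cut into the kids that hang off the path and
the string of the last variable (into its kids if its rule is a sequence; otherwise a new node is
made for it). The string of each variable on the path is an infix of that of `v`. -/
theorem exists_decomposition (hB : G.len G.root ≤ B) (v : Fin (G.top + 1)) :
    ∀ M : List IndexNode, G.Reachable v → StoreBounded B M →
    (∀ x, G.Reachable x → G.rank x < G.rank v → G.Stored B M x) →
    ∃ (N : List IndexNode) (xs : List (List ℕ)),
      N.length + xs.length ≤ 1 + ∑ u ∈ G.centroidPath v, (G.rule u).size ∧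
      StoreBounded B (M ++ N) ∧ Decomposes B (M ++ N) (4 * G.rank v + 2) (G.str v) xs ∧
      ∀ u ∈ G.centroidPath v, G.str u <:+: G.str v := by
  induction v using WellFoundedLT.induction with
  | _ v ih =>
    intro M hv hM hstored
    have hlen : (G.str v).length ≤ B := hv.len_le.trans hB
    by_cases he : ∃ w, G.CentroidEdge v w
    · obtain ⟨w, hw⟩ := he
      obtain ⟨l, r, hlr, hlt⟩ := hw.exists_split
      have hwr := hw.2.2
      obtain ⟨N, xs, hcard, hb, ⟨hflat, hne, hxs⟩, hinf⟩ := ih w (lt_of_mem_kids hw.2.1) M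
        (hv.of_mem_kids hw.2.1) hM (fun x hx hr => hstored x hx (hr.trans_eq hwr))
      have hsize : l.length + r.length + 1 = (G.rule v).size := by
        have hlen' : (G.kids v).length = l.length + r.length + 1 := by
          rw [hlr]; simp; omega
        cases hr : G.rule v with
        | terminal a => simp [kids_of_terminal hr] at hlr
        | seq Bs hk =>
          rw [kids_of_seq hr] at hlen'
          simpa [RLRule.size] using hlen'.symm
        | power C t ht =>
          -- all kids of a power rule are equal, so none of them can be lighter than another
          exfalso
          rw [kids_of_power hr] at hlr hlen'
          have hall : ∀ x ∈ l ++ w :: r, x = Fin.castLE v.2.le C :=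
            fun x hx => List.eq_of_mem_replicate (hlr ▸ hx)
          have hwC := hall w (by simp)
          rw [List.length_replicate] at hlen'
          have hlr' : l ++ r ≠ [] := fun h => by
            have := congrArg List.length h
            simp only [List.length_append, List.length_nil] at this
            omega
          obtain ⟨x, hx⟩ := List.exists_mem_of_ne_nil _ hlr'
          rw [List.mem_append] at hx
          have hxC := hall x (by rcases hx with hx | hx <;> simp [hx])
          have := hlt x hx
          rw [hxC, ← hwC] at this
          omega
      obtain ⟨hp, hnot⟩ := centroidPath_of_edge hw
      have hstr : G.str v = (l.map G.str).flatten ++ (G.str w ++ (r.map G.str).flatten) := by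
        rw [str_of_mem_kids hw.2.1, hlr]
        simp
      refine ⟨N, l.map G.str ++ (xs ++ r.map G.str), ?_, hb, ⟨?_, ?_, ?_⟩, ?_⟩
      · rw [hp, Finset.sum_insert hnot, ← hsize]
        simp only [List.length_append, List.length_map]
        omega
      · rw [hstr, ← hflat]
        simp
      · simp [hne]
      · have hkid : ∀ x, x ∈ l ∨ x ∈ r → G.str x ≠ [] ∧ Accessible B (M ++ N) (G.str x)
            (4 * G.rank v + 2 + 2 * Nat.log 2 (G.str x).length) := by
          intro x hx
          have hxk : x ∈ G.kids v := by
            rw [hlr]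
            rcases hx with hx | hx <;> simp [hx]
          have := (hstored x (hv.of_mem_kids hxk) (hlt x hx)).item (hlt x hx)
          exact ⟨this.1, this.2.append_store N⟩
        intro y hy
        rw [List.mem_append, List.mem_append, List.mem_map, List.mem_map] at hy
        rcases hy with ⟨x, hx, rfl⟩ | hy | ⟨x, hx, rfl⟩
        · exact hkid x (.inl hx)
        · rw [← hwr]
          exact hxs y hy
        · exact hkid x (.inr hx)
      · intro u hu
        rw [hp, Finset.mem_insert] at hu
        rcases hu with rfl | hu
        · exact List.infix_rfl
        · exact (hinf u hu).trans ⟨(l.map G.str).flatten, (r.map G.str).flatten, by simp [hstr]⟩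
    · push Not at he
      have hlt : ∀ k ∈ G.kids v, G.rank k < G.rank v := fun k hk =>
        lt_of_le_of_ne (rank_le_of_mem_kids hk) fun h => he k ⟨hv, hk, h⟩
      rw [centroidPath_of_no_edge he]
      simp only [Finset.sum_singleton, Finset.mem_singleton, forall_eq, List.infix_rfl, and_true]
      cases hr : G.rule v with
      | terminal a =>
        obtain ⟨nd, hb, hacc⟩ := exists_accessible_letter hM
          ((len_pos v).trans_le hlen) a
        refine ⟨[nd], [G.str v], by simp [RLRule.size], hb, by simp, by simp, ?_⟩
        intro y hy
        rw [List.mem_singleton.1 hy]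
        refine ⟨str_ne_nil v, ?_⟩
        rw [str_of_terminal hr]
        exact hacc.mono (by omega)
      | seq Bs hk =>
        have hkids : (G.kids v).length = Bs.length := by rw [kids_of_seq hr]; simp
        refine ⟨[], (G.kids v).map G.str, ?_, by simpa using hM, (str_of_seq hr).symm, ?_, ?_⟩
        · simp [RLRule.size, hkids]
        · intro h
          have := congrArg List.length h
          simp only [List.length_map, List.length_nil] at this
          omega
        · intro y hy
          obtain ⟨x, hx, rfl⟩ := List.mem_map.1 hy
          rw [List.append_nil]
          exact (hstored x (hv.of_mem_kids hx) (hlt x hx)).item (hlt x hx)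
      | power C t ht =>
        have hC : Fin.castLE v.2.le C ∈ G.kids v := by
          rw [kids_of_power hr]; simp; omega
        set k := Fin.castLE v.2.le C with hkdef
        have hstr : G.str v = (List.replicate t (G.str k)).flatten := by
          rw [str_of_power hr, kids_of_power hr, List.map_replicate]
        have hk := hlt k hC
        obtain ⟨nd, hb, hacc⟩ := exists_accessible_power hM (by omega : 1 ≤ t) (str_ne_nil k)
          (by rwa [← hstr]) (hstored k (hv.of_mem_kids hC) hk)
        refine ⟨[nd], [G.str v], by simp [RLRule.size], hb, by simp, by simp, ?_⟩
        intro y hy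
        rw [List.mem_singleton.1 hy]
        refine ⟨str_ne_nil v, ?_⟩
        rw [← hstr] at hacc
        refine hacc.mono ?_
        -- `log |C| + log t ≤ log (t * |C|)`
        have hlog : Nat.log 2 (G.len k) + Nat.log 2 t ≤ Nat.log 2 (G.str v).length := by
          refine Nat.le_log_of_pow_le one_lt_two ?_
          rw [pow_add, hstr]
          simp only [List.length_flatten, List.map_replicate, List.sum_replicate, smul_eq_mul]
          rw [mul_comm]
          exact Nat.mul_le_mul (Nat.pow_log_le_self 2 (by omega))
            (Nat.pow_log_le_self 2 (len_pos k).ne')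
        omega

/-- One biased search tree serves all variables of a path: they have infixes of its
string, and their lengths have the same logarithm. -/
theorem exists_stored_path (hB : G.len G.root ≤ B) {v : Fin (G.top + 1)} {M : List IndexNode}
    (hv : G.Reachable v) (hM : StoreBounded B M)
    (hstored : ∀ x, G.Reachable x → G.rank x < G.rank v → G.Stored B M x) :
    ∃ N : List IndexNode, N.length ≤ ∑ u ∈ G.centroidPath v, (G.rule u).size ∧
      StoreBounded B (M ++ N) ∧ ∀ u ∈ G.centroidPath v, G.Stored B (M ++ N) u := by
  obtain ⟨N, xs, hcard, hb, ⟨hflat, hne, hxs⟩, hinf⟩ := exists_decomposition hB v M hv hM hstored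
  obtain ⟨N', hcard', hb', hacc⟩ := exists_accessible_flatten _ xs _ rfl hne hb hxs
    (by rw [hflat]; exact hv.len_le.trans hB)
  refine ⟨N ++ N', by rw [List.length_append]; omega, by rwa [← List.append_assoc], ?_⟩
  intro u hu
  obtain ⟨-, h2, h3, -⟩ := path_spec (mem_centroidPath.1 hu) hv
  rw [hflat, List.append_assoc] at hacc
  refine (hacc.of_infix (hinf u hu)).mono ?_
  rw [h2, h3, len]
  omega

/-- The paths are stored in the order of their ranks, so that the kids that hang off a path are
stored before it. -/
theorem exists_stored_heads (hB : G.len G.root ≤ B) (S : Finset (Fin (G.top + 1))) :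
    S ⊆ G.heads → (∀ h ∈ S, ∀ g ∈ G.heads, G.rank g < G.rank h → g ∈ S) →
    ∃ M : List IndexNode, M.length ≤ ∑ h ∈ S, ∑ u ∈ G.centroidPath h, (G.rule u).size ∧
      StoreBounded B M ∧ ∀ h ∈ S, ∀ u ∈ G.centroidPath h, G.Stored B M u := by
  induction S using Finset.induction_on_max_value G.rank with
  | empty => exact fun _ _ => ⟨[], by simp, by simp [StoreBounded], by simp⟩
  | insert h S hnot hmax ih =>
    intro hsub hclosed
    obtain ⟨M, hcard, hb, hst⟩ := ih ((Finset.subset_insert _ _).trans hsub) fun g hg g' hg' hlt =>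
      (Finset.mem_insert.1 (hclosed g (Finset.mem_insert_of_mem hg) g' hg' hlt)).resolve_left
        (by rintro rfl; exact absurd (hmax g hg) (not_le.2 hlt))
    have hh := mem_heads.1 (hsub (Finset.mem_insert_self h S))
    obtain ⟨N, hN, hb', hst'⟩ := exists_stored_path hB hh.1 hb fun x hx hlt => by
      obtain ⟨g, hg, hxg⟩ := exists_head hx
      have hrank := (path_spec (mem_centroidPath.1 hxg) (mem_heads.1 hg).1).2.1
      have hgS := hclosed h (Finset.mem_insert_self h S) g hg (by omega)
      rcases Finset.mem_insert.1 hgS with rfl | hgS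
      · omega
      · exact hst g hgS x hxg
    refine ⟨M ++ N, ?_, hb', ?_⟩
    · rw [Finset.sum_insert hnot, List.length_append]
      omega
    · intro g hg u hu
      rcases Finset.mem_insert.1 hg with rfl | hg
      · exact hst' u hu
      · exact (hst g hg u hu).append_store N

/-- The paths are disjoint, so the store has at most as many nodes as the grammar has size; ranks are
at most `2 * log n`. -/
theorem exists_store (G : RLSLP ℕ) : ∃ M : List IndexNode, M.length ≤ G.size ∧
    StoreBounded G.word.length M ∧
    Accessible G.word.length M G.word (10 * Nat.log 2 G.word.length + 4) := by
  obtain ⟨M, hcard, hb, hst⟩ := exists_stored_heads (G := G) (B := G.word.length) le_rfl G.heads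
    subset_rfl fun _ _ g hg _ => hg
  have hroot : G.Reachable G.root := by rw [Reachable, occ_self]; exact one_pos
  obtain ⟨h, hh, hp⟩ := exists_head hroot
  refine ⟨M, hcard.trans ?_, hb, (hst h hh _ hp).mono ?_⟩
  · rw [← Finset.sum_biUnion heads_pairwiseDisjoint]
    exact Finset.sum_le_sum_of_subset (Finset.subset_univ _)
  · have : G.len G.root = G.word.length := rfl
    rw [rank, occ_self, this]
    simp only [Nat.log_one_right, Nat.sub_zero]
    omega

end

end RLSLP

/-! ### Smallest grammars -/

section trivialGrammar
variable {α : Type*}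

/-- The grammar with one variable for each letter and a start rule that lists them. It shows
that `grl w` is at most linear in the length, so that addresses fit into a word. -/
def trivialRLSLP (w : List α) (hw : 1 < w.length) : RLSLP α where
  top := w.length
  rule i := if h : (i : ℕ) < w.length then .terminal w[i]
    else .seq (List.finRange i) (by rw [List.length_finRange]; omega)

theorem trivialRLSLP_expand {w : List α} (hw : 1 < w.length) {i : ℕ} (hi : i < w.length) :
    (trivialRLSLP w hw).expand i (Nat.lt_succ_of_lt hi) = [w[i]] := by
  rw [RLSLP.expand]
  simp [trivialRLSLP, hi]

theorem trivialRLSLP_word {w : List α} (hw : 1 < w.length) : (trivialRLSLP w hw).word = w := by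
  have hr : (trivialRLSLP w hw).rule (trivialRLSLP w hw).root =
      .seq (List.finRange (trivialRLSLP w hw).root) (by rw [List.length_finRange]; exact hw) := by
    simp [trivialRLSLP, RLSLP.root]
  have hstr : (trivialRLSLP w hw).word = _ := RLSLP.str_of_seq hr
  rw [hstr, RLSLP.kids_of_seq hr, List.map_map]
  have hfun : (trivialRLSLP w hw).str ∘ Fin.castLE (trivialRLSLP w hw).root.2.le =
      fun k : Fin w.length => [w.get k] := funext fun k => trivialRLSLP_expand hw k.2
  have hflat : ∀ l : List (Fin w.length), (l.map fun k => [w.get k]).flatten = l.map w.get := by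
    intro l
    induction l with
    | nil => rfl
    | cons k l ih => rw [List.map_cons, List.flatten_cons, ih, List.map_cons, List.singleton_append]
  refine (congrArg List.flatten (congrArg (List.map · (List.finRange w.length)) hfun)).trans ?_
  exact (hflat _).trans (by rw [← List.ofFn_eq_map, List.ofFn_get])

theorem trivialRLSLP_size {w : List α} (hw : 1 < w.length) :
    (trivialRLSLP w hw).size = 2 * w.length := by
  change ∑ i : Fin (w.length + 1), ((trivialRLSLP w hw).rule i).size = 2 * w.length
  rw [Fin.sum_univ_castSucc]
  simp [trivialRLSLP, RLRule.size, two_mul]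

theorem exists_rlslp_size_le {w : List α} (hw : w ≠ []) :
    ∃ G : RLSLP α, G.word = w ∧ G.size ≤ 2 * w.length := by
  rcases Nat.lt_or_ge 1 w.length with h | h
  · exact ⟨trivialRLSLP w h, trivialRLSLP_word h, (trivialRLSLP_size h).le⟩
  · obtain ⟨a, rfl⟩ : ∃ a, w = [a] := by
      rw [← List.length_eq_one_iff]
      have := List.length_pos_iff.2 hw
      omega
    refine ⟨⟨0, fun _ => .terminal a⟩, ?_, ?_⟩
    · rw [RLSLP.word, RLSLP.expand]
    · simp [RLSLP.size, RLRule.size]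

theorem exists_rlslp_size_eq_grl {w : List α} (hw : w ≠ []) :
    ∃ G : RLSLP α, G.word = w ∧ G.size = grl w ∧ grl w ≤ 2 * w.length := by
  obtain ⟨G₀, h₀, hle⟩ := exists_rlslp_size_le hw
  have hne : {s | ∃ G : RLSLP α, G.word = w ∧ G.size = s}.Nonempty := ⟨_, G₀, h₀, rfl⟩
  obtain ⟨G, hG, hs⟩ := Nat.sInf_mem hne
  have hmin : grl w ≤ G₀.size := Nat.sInf_le ⟨G₀, h₀, rfl⟩
  exact ⟨G, hG, hs, hmin.trans hle⟩

theorem RLSLP.size_pos (G : RLSLP α) : 0 < G.size := by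
  refine Finset.sum_pos (s := Finset.univ) (fun i _ => ?_) Finset.univ_nonempty
  cases G.rule i with
  | terminal a => exact one_pos
  | seq Bs hk => exact zero_lt_one.trans hk
  | power B t ht => exact two_pos

end trivialGrammar

/-! ### Fingerprint indexes -/

theorem RAMAnswers.mono {P : List RAMInstr} {W j T T' r : ℕ} {M : List ℕ}
    (h : RAMAnswers P W M j T r) (hT : T ≤ T') : RAMAnswers P W M j T' r := by
  obtain ⟨k, hk, h⟩ := h
  exact ⟨k, hk.trans hT, h⟩

theorem exists_index {μ : ℕ} [Fact μ.Prime] {c : ZMod μ} (hc : c ≠ 0) {W B d : ℕ}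
    (hμ : μ * μ < 2 ^ W) (hBW : B < 2 ^ W) {M : List IndexNode} (hMW : 12 * M.length + 17 < 2 ^ W)
    (hM : StoreBounded B M) {x : List ℕ} (hx : Accessible B M x d) :
    ∃ I : List ℕ, (∀ v ∈ I, v < 2 ^ W) ∧ I.length = 12 * M.length + 5 ∧ ∀ j ≤ x.length,
      RAMAnswers fingerprintProgram W I j (45 * d + 21) (fingerprint c (x.take j)).val := by
  obtain ⟨e, post, d', hd, h⟩ := hx
  refine ⟨encodeIndex c e M, ?_, length_encodeIndex c e M, fun j hj =>
    (ramAnswers_of_represents hc hμ hBW hMW h hj).mono (by omega)⟩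
  have : 1 < μ := (Fact.out : μ.Prime).one_lt
  exact hM.encode_lt (link_bounded h) (by nlinarith) hBW (by omega)

/-- A store of constant size for the string `a 0 ⋯ 0`, which replaces `w` when `c = 0`. -/
theorem exists_store_cons_zeros (a : ℕ) {n : ℕ} (hn : 1 ≤ n) :
    ∃ M : List IndexNode, M.length = 4 ∧ StoreBounded (n + 1) M ∧
      Accessible (n + 1) M (a :: List.replicate n 0) (Nat.log 2 n + 4) := by
  have hflat : (List.replicate n [0]).flatten = List.replicate n 0 := by simp
  obtain ⟨m₁, hb₁, h₁⟩ := exists_accessible_letter (B := n + 1) (M := [])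
    (by simp [StoreBounded]) (by omega) a
  obtain ⟨m₂, hb₂, h₂⟩ := exists_accessible_letter hb₁ (by omega) 0
  obtain ⟨m₃, hb₃, h₃⟩ := exists_accessible_power (t := n) hb₂ hn (by simp) (by simp) h₂
  obtain ⟨m₄, hb₄, h₄⟩ := exists_accessible_append (d := Nat.log 2 n + 3) hb₃ (by simp)
    (by simp) (((h₁.append_store [m₂]).append_store [m₃]).mono (by omega))
    (h₃.mono (by omega))
  refine ⟨_, by simp, hb₄, ?_⟩
  rw [hflat] at h₄
  exact h₄

/-- For `c = 0` only the first letter matters, and zeros after it do not change the fingerprint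
for `c = 1`. -/
theorem fingerprint_zero_take {R : Type*} [CommRing R] {a : ℕ} {x : List ℕ} (n j : ℕ) :
    fingerprint (0 : R) ((a :: x).take j) =
      fingerprint 1 ((a :: List.replicate n 0).take j) := by
  have h : ∀ m : ℕ, fingerprint (1 : R) (List.replicate m 0) = 0 := by
    intro m
    induction m with
    | zero => rfl
    | succ m ih => simp [List.replicate_succ, fingerprint, ih]
  cases j with
  | zero => rfl
  | succ j => simp [fingerprint, List.take_replicate, h]

theorem pow_six_lt_two_pow {x W : ℕ} (hx : 2 ≤ x) (hW : 12 * Nat.log 2 x ≤ W) :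
    x ^ 6 < 2 ^ W := by
  have hlog : 1 ≤ Nat.log 2 x := Nat.log_pos one_lt_two hx
  have h1 : x < 2 ^ (2 * Nat.log 2 x) :=
    (Nat.lt_pow_succ_log_self one_lt_two x).trans_le (Nat.pow_le_pow_right two_pos (by omega))
  calc x ^ 6 < (2 ^ (2 * Nat.log 2 x)) ^ 6 := Nat.pow_lt_pow_left h1 (by omega)
    _ = 2 ^ (12 * Nat.log 2 x) := by rw [← pow_mul]; congr 1; ring
    _ ≤ 2 ^ W := Nat.pow_le_pow_right two_pos hW

theorem theorem2 :
    ∃ (P : List RAMInstr) (C K : ℕ),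
      ∀ (w : List ℕ), w ≠ [] →
      ∀ (c : ℤ) (μ : ℕ), μ.Prime →
      ∀ (W : ℕ), K * Nat.log 2 (w.length + μ) ≤ W →
        ∃ M : List ℕ, (∀ x ∈ M, x < 2 ^ W) ∧ M.length ≤ C * grl w ∧
          ∀ j ≤ w.length,
            RAMAnswers P W M j (C * (Nat.log 2 w.length + 1)) (karpRabin c μ (w.take j)) := by
  refine ⟨fingerprintProgram, 450, 12, fun w hw c μ hμ W hW => ?_⟩
  have : Fact μ.Prime := ⟨hμ⟩
  have hn : 1 ≤ w.length := List.length_pos_iff.2 hw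
  have hμ2 := hμ.two_le
  obtain ⟨G, hword, hsize, hgrl⟩ := exists_rlslp_size_eq_grl hw
  have hpos : 0 < grl w := hsize ▸ G.size_pos
  have hpow := pow_six_lt_two_pow (x := w.length + μ) (by omega) hW
  have hlin : 243 * (w.length + μ) < 2 ^ W := by
    refine lt_of_le_of_lt ?_ hpow
    rw [pow_succ]
    exact Nat.mul_le_mul_right _ (Nat.pow_le_pow_left (show 3 ≤ w.length + μ by omega) 5)
  have hsq : μ * μ < 2 ^ W := by
    refine lt_of_le_of_lt ?_ hpow
    calc μ * μ = μ ^ 2 := (sq μ).symm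
      _ ≤ (w.length + μ) ^ 2 := Nat.pow_le_pow_left (by omega) 2
      _ ≤ (w.length + μ) ^ 6 := Nat.pow_le_pow_right (by omega) (by omega)
  simp only [karpRabin_eq]
  -- links need an inverse of `c`; for `c = 0` a string with the same fingerprints for `1` is used
  rcases eq_or_ne (c : ZMod μ) 0 with hc | hc
  · obtain ⟨a, x, rfl⟩ := List.exists_cons_of_ne_nil hw
    obtain ⟨M, hM4, hM, hacc⟩ := exists_store_cons_zeros a hn
    obtain ⟨I, hI, hlen, hans⟩ := exists_index (c := (1 : ZMod μ)) one_ne_zero hsq (by omega)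
      (by omega) hM hacc
    refine ⟨I, hI, by omega, fun j hj => ?_⟩
    rw [hc, fingerprint_zero_take (a :: x).length]
    exact (hans j (by rw [List.length_cons, List.length_replicate]; omega)).mono (by omega)
  · obtain ⟨M, hcard, hM, hacc⟩ := G.exists_store
    rw [hword] at hM hacc
    obtain ⟨I, hI, hlen, hans⟩ := exists_index hc hsq (by omega) (by omega) hM hacc
    exact ⟨I, hI, by omega, fun j hj => (hans j hj).mono (by omega)⟩
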